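/- Let $k$ be a finite field with $q$ elements; tensor products are over $k$. Let $A=k[t]$, where $t$ is the standard coordinate on $\mathbf{P}^1_k$, let $\infty\in\mathbf{P}^1_k$ be the pole of $t$ and $F=k(t)$. Let $X$ be a smooth projective geometrically connected curve over $k$ with a surjective $k$-morphism $X\to\mathbf{P}^1_k$, let $K$ be its function field, and let $Y\subset X$ be the inverse image of $\operatorname{Spec}A=\mathbf{P}^1_k\setminus\{\infty\}$. For $z\in X\setminus Y$ let $K_z$ be the completion of $K$ at $z$. Let $\mathcal{O}_X(\infty)$ be the pullback to $X$ of the sheaf $\mathcal{O}_{\mathbf{P}^1}(\infty)$ of functions on $\mathbf{P}^1_k$ with a pole of order at most $1$ at $\infty$. For a scheme $S$ over $\operatorname{Spec}A$ let $C_0(S)$ be the $k$-vector space $\Gamma(S,\mathcal{O}_S)$ with the $A$-module structure in which $t$ acts by $c\mapsto tc+c^q$ (the Carlitz module). Let $\exp x=x+e_1x^q+e_2x^{q^2}+\cdots\in F[[x]]$ be the Carlitz exponential, the unique power series of this form with $\exp(tx)=t\exp x+(\exp x)^q$; it converges on every $K_z$ with $z\in X\setminus Y$. Let $C$ be the sheaf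 of $A$-modules on $X$ given by $$C(U)=\Big\{(c,(\gamma_z)_z)\in C_0(U\cap Y)\times\prod_{z\in U\setminus Y}K_z \;\Big|\; \exp\gamma_z=c \text{ in } K_z \text{ for all } z\in U\setminus Y\Big\},$$ where $A$ acts on $K_z$ by multiplication. Then there is a short exact sequence of sheaves of $A$-modules on $X$ $$0\longrightarrow \mathcal{O}_X\otimes A\overset{\partial}{\longrightarrow}\mathcal{O}_X(\infty)\otimes A\longrightarrow C\longrightarrow 0,$$ where $\partial(f\otimes a)=f\otimes ta-(tf+f^q)\otimes a$. -/

import Mathlib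

open CategoryTheory AlgebraicGeometry TopologicalSpace Opposite
open scoped Polynomial TensorProduct

universe u

noncomputable section

theorem isDomain_of_principal_maximalIdeal {S : Type u} [CommRing S] [IsLocalRing S]
    [IsNoetherianRing S] (ϖ : S) (hϖ : IsLocalRing.maximalIdeal S = Ideal.span {ϖ})
    (hreg : ϖ = 0 ∨ ϖ ∈ nonZeroDivisors S) : IsDomain S := by
  rcases hreg with h0 | hreg
  · have : IsField S := by
      rw [IsLocalRing.isField_iff_maximalIdeal_eq, hϖ, h0]; simp
    exact this.isDomain
  have key : ∀ a : S, a ≠ 0 → ∃ (n : ℕ) (u : Sˣ), a = u * ϖ ^ n := by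
    intro a ha
    have hK := Ideal.iInf_pow_eq_bot_of_isLocalRing (IsLocalRing.maximalIdeal S)
      (IsLocalRing.maximalIdeal.isMaximal S).ne_top
    have : ∃ n, a ∉ IsLocalRing.maximalIdeal S ^ n := by
      by_contra! h
      exact ha (by simpa [hK] using (Submodule.mem_iInf _).mpr h)
    classical
    obtain ⟨n, hn, hmin⟩ : ∃ n, a ∉ IsLocalRing.maximalIdeal S ^ n ∧
        ∀ m < n, a ∈ IsLocalRing.maximalIdeal S ^ m :=
      ⟨Nat.find this, Nat.find_spec this, fun m hm => by
        simpa using Nat.find_min this hm⟩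
    obtain _ | n := n
    · simp at hn
    have h1 := hmin n (Nat.lt_succ_self n)
    rw [hϖ, Ideal.span_singleton_pow, Ideal.mem_span_singleton'] at h1
    obtain ⟨b, hb⟩ := h1
    have hbu : IsUnit b := by
      by_contra hb'
      have : b ∈ IsLocalRing.maximalIdeal S := hb'
      apply hn
      rw [← hb, pow_succ']
      refine Ideal.mul_mem_mul this (Ideal.pow_mem_pow ?_ n)
      rw [hϖ]; exact Ideal.mem_span_singleton_self ϖ
    exact ⟨n, hbu.unit, hb.symm⟩
  have : NoZeroDivisors S := by
    constructor
    intro a b hab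
    by_contra! h
    obtain ⟨n, u, rfl⟩ := key a h.1
    obtain ⟨m, v, rfl⟩ := key b h.2
    have h2 : ϖ ^ (n + m) = 0 := by
      have : (↑(u * v) : S) * ϖ ^ (n + m) = 0 := by rw [← hab]; push_cast; ring
      exact (Units.mul_right_eq_zero _).mp this
    have := pow_mem hreg (n + m)
    rw [h2] at this
    exact zero_notMem_nonZeroDivisors this
  exact NoZeroDivisors.to_isDomain S

open IsLocalRing in
/-- The localization at a prime of an étale algebra over `k[x]` is a Dedekind domain
(a field or a discrete valuation ring). -/
theorem isDedekindDomain_of_etale_polynomial {k S L : Type u} [Field k] [CommRing S]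
    (g : MvPolynomial (Fin 1) k →+* S) (hg : g.Etale) (p : Ideal S) [p.IsPrime]
    [CommRing L] [Algebra S L] [IsLocalization.AtPrime L p] : IsDedekindDomain L := by
  algebraize [g, (algebraMap S L).comp g]
  let R := MvPolynomial (Fin 1) k
  have : IsPrincipalIdealRing R :=
    IsPrincipalIdealRing.of_surjective (MvPolynomial.uniqueAlgEquiv k (Fin 1)).symm.toRingHom
      (AlgEquiv.surjective _)
  let p' : Ideal R := p.under R
  let Rp := Localization.AtPrime p'
  have : IsPrincipalIdealRing Rp := IsPrincipalIdealRing.of_isNoetherianRing_of_isBezout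
  have : IsLocalRing L := IsLocalization.AtPrime.isLocalRing L p
  have : IsNoetherianRing S := Algebra.FiniteType.isNoetherianRing R S
  have : IsNoetherianRing L := IsLocalization.isNoetherianRing p.primeCompl L inferInstance
  let φ : Rp →+* L := IsLocalization.lift (M := p'.primeCompl) (g := algebraMap R L) (by
    rintro ⟨y, hy⟩
    rw [IsScalarTower.algebraMap_apply R S L]
    exact IsLocalization.map_units L (⟨algebraMap R S y, hy⟩ : p.primeCompl))
  algebraize [φ]
  have : IsScalarTower R Rp L := .of_algebraMap_eq fun x => by
    simp [RingHom.algebraMap_toAlgebra, φ]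
  have : IsLocalHom (algebraMap Rp L) := by
    constructor
    intro a ha
    obtain ⟨x, y, rfl⟩ := IsLocalization.exists_mk'_eq p'.primeCompl a
    rw [IsLocalization.AtPrime.isUnit_mk'_iff Rp p']
    intro hx
    have hx' : algebraMap R L x ∈ maximalIdeal L := by
      rw [IsScalarTower.algebraMap_apply R S L]
      exact (IsLocalization.AtPrime.to_map_mem_maximal_iff L p _).mpr hx
    apply hx'
    rw [IsScalarTower.algebraMap_apply R Rp L, ← IsLocalization.mk'_spec Rp x y, map_mul]
    refine ha.mul ?_
    exact (IsLocalization.map_units Rp y).map _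
  have : Algebra.FormallyEtale S L := .of_isLocalization p.primeCompl
  have : Algebra.FormallyEtale R L := .comp R S L
  have : Algebra.FormallyUnramified Rp L := .of_restrictScalars R Rp L
  have : Algebra.EssFiniteType S L := .of_isLocalization L p.primeCompl
  have : Algebra.EssFiniteType R L := .comp R S L
  have : Algebra.EssFiniteType Rp L := .of_comp R Rp L
  have : Module.Flat S L := IsLocalization.flat L p.primeCompl
  have : Module.Flat R L := .trans R S L
  have : Module.Flat Rp L := (Module.flat_iff_of_isLocalization Rp p'.primeCompl L).mpr ‹_›
  obtain ⟨ϖ, hϖ⟩ := (IsPrincipalIdealRing.principal (maximalIdeal Rp)).principal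
  have hmax : maximalIdeal L = Ideal.span {algebraMap Rp L ϖ} := by
    rw [← Algebra.FormallyUnramified.map_maximalIdeal (R := Rp), hϖ]
    exact (Ideal.map_span _ _).trans (by simp)
  have hdom : IsDomain L := by
    refine isDomain_of_principal_maximalIdeal _ hmax ?_
    by_cases h : ϖ = 0
    · simp [h]
    · right
      have h1 : IsSMulRegular L ϖ :=
        Module.Flat.isSMulRegular_of_nonZeroDivisors (mem_nonZeroDivisors_of_ne_zero h)
      rw [mem_nonZeroDivisors_iff_right]
      intro x hx
      apply h1
      simp [Algebra.smul_def, mul_comm, hx]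
  by_cases hf : IsField L
  · let := hf.toField
    infer_instance
  · have : (maximalIdeal L).IsPrincipal := ⟨⟨_, hmax⟩⟩
    have : IsDiscreteValuationRing L := ((IsDiscreteValuationRing.TFAE L hf).out 4 0).mp this
    infer_instance

/-- The local rings of a smooth curve over a field are Dedekind domains. -/
theorem isDedekindDomain_stalk_of_smooth {k : Type u} [Field k] {X : Scheme.{u}}
    (f : X ⟶ Spec (.of k)) [SmoothOfRelativeDimension 1 f] (x : X) :
    IsDedekindDomain (X.presheaf.stalk x) := by
  obtain ⟨U, hU, V, hV, hxV, e, hst⟩ :=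
    SmoothOfRelativeDimension.exists_isStandardSmoothOfRelativeDimension (n := 1) (f := f) x
  have hUne : U = ⊤ := by
    rw [eq_top_iff]
    intro y _
    have : y = f x := Subsingleton.elim _ _
    exact this ▸ e hxV
  have hfield : IsField Γ(Spec (.of k), U) := by
    subst hUne
    exact isField_of_isIntegral_of_subsingleton (Spec (.of k))
  let := hfield.toField
  obtain ⟨g, -, hg⟩ := hst.exists_etale_mvPolynomial
  let := TopCat.Presheaf.algebra_section_stalk X.presheaf ⟨x, hxV⟩
  have := hV.isLocalization_stalk ⟨x, hxV⟩
  exact isDedekindDomain_of_etale_polynomial g hg (hV.primeIdealOf ⟨x, hxV⟩).asIdeal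

/-- A smooth proper geometrically connected curve over a field is integral. -/
theorem isIntegral_of_smooth {k : Type u} [Field k] {X : Scheme.{u}}
    (f : X ⟶ Spec (.of k)) [SmoothOfRelativeDimension 1 f] [IsProper f]
    [GeometricallyConnected f] : IsIntegral X := by
  have := isDedekindDomain_stalk_of_smooth f
  have hconn : ConnectedSpace X := GeometricallyConnected.connectedSpace_of_subsingleton f
  have : IsReduced X := isReduced_of_isReduced_stalk X
  have : IsLocallyNoetherian X := LocallyOfFiniteType.isLocallyNoetherian f
  have : CompactSpace X := by
    exact QuasiCompact.compactSpace_of_compactSpace f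
  have : IsNoetherian X := {}
  have hfin : (irreducibleComponents X).Finite := TopologicalSpace.NoetherianSpace.finite_irreducibleComponents
  have huniq : ∀ Z ∈ irreducibleComponents X, ∀ Z' ∈ irreducibleComponents X,
      ∀ x, x ∈ Z → x ∈ Z' → Z = Z' := by
    intro Z hZ Z' hZ' x hx hx'
    have hW : IsIrreducible (closure (Set.range (X.fromSpecStalk x))) := by
      apply IsIrreducible.closure
      rw [← Set.image_univ]
      exact (IrreducibleSpace.isIrreducible_univ _).image _ (X.fromSpecStalk x).continuous.continuousOn
    have key : ∀ Z ∈ irreducibleComponents X, x ∈ Z →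
        Z = closure (Set.range (X.fromSpecStalk x)) := by
      intro Z hZ hx
      obtain ⟨η, hη⟩ := QuasiSober.sober hZ.1 (isClosed_of_mem_irreducibleComponents Z hZ)
      refine le_antisymm ?_ (hZ.2 hW ?_)
      all_goals
        rw [← hη.def]
        refine closure_mono ?_
        rw [Set.singleton_subset_iff, Scheme.range_fromSpecStalk]
        exact hη.specializes hx
    rw [key Z hZ hx, key Z' hZ' hx']
  have : IrreducibleSpace X := by
    obtain ⟨x⟩ := hconn.toNonempty
    let Z := irreducibleComponent x
    have hZ : Z ∈ irreducibleComponents X := irreducibleComponent_mem_irreducibleComponents x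
    have hclopen : IsClopen Z := by
      refine ⟨isClosed_irreducibleComponent, ?_⟩
      have : Z = (⋃₀ (irreducibleComponents X \ {Z}))ᶜ := by
        ext y
        simp only [Set.mem_compl_iff, Set.mem_sUnion, not_exists, not_and]
        constructor
        · rintro hy Z' ⟨hZ', hne⟩ hy'
          exact hne (huniq Z' hZ' Z hZ y hy' hy)
        · intro h
          by_contra hy
          exact h (irreducibleComponent y) ⟨irreducibleComponent_mem_irreducibleComponents y,
            fun h' => hy ((h' : _ = Z) ▸ mem_irreducibleComponent)⟩ mem_irreducibleComponent
      rw [this, isOpen_compl_iff]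
      rw [Set.sUnion_eq_biUnion]
      exact (hfin.subset Set.sdiff_subset).isClosed_biUnion
        fun Z' hZ' => isClosed_of_mem_irreducibleComponents Z' hZ'.1
    have huniv : Z = Set.univ := hclopen.eq_univ ⟨x, mem_irreducibleComponent⟩
    rw [irreducibleSpace_def, Set.top_eq_univ, ← huniv]
    exact isIrreducible_irreducibleComponent
  exact isIntegral_of_irreducibleSpace_of_isReduced X

instance P1.gradedAlgebra (k : Type u) [Field k] :
    GradedAlgebra (MvPolynomial.homogeneousSubmodule (Fin 2) k) :=
  MvPolynomial.gradedAlgebra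

/-- The projective line over `k`, with homogeneous coordinates `X 0` and `X 1`. -/
abbrev P1 (k : Type u) [Field k] : Scheme.{u} :=
  Proj (MvPolynomial.homogeneousSubmodule (Fin 2) k)

namespace P1

variable (k : Type u) [Field k]

/-- The structure morphism of the projective line. -/
def str : P1 k ⟶ Spec (.of k) :=
  Proj.toSpecZero _ ≫ Spec.map (CommRingCat.ofHom
    (algebraMap k (MvPolynomial.homogeneousSubmodule (Fin 2) k 0)))

/-- The open subset `Xᵢ ≠ 0`. The affine line `Spec k[t]` is `chart k 1`, and its
complement is the point `∞ = [1 : 0]`. -/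
def chart (i : Fin 2) : (P1 k).Opens := Proj.basicOpen _ (MvPolynomial.X i)

/-- The function `Xⱼ / Xᵢ` on the open subset `Xᵢ ≠ 0`. -/
def ratio (i j : Fin 2) : Γ(P1 k, chart k i) :=
  Proj.awayToSection _ _ (HomogeneousLocalization.Away.mk
    (MvPolynomial.homogeneousSubmodule (Fin 2) k) (f := MvPolynomial.X i) (d := 1)
    (MvPolynomial.isHomogeneous_X k i) 1 (MvPolynomial.X j)
    (by simpa using MvPolynomial.isHomogeneous_X k j))

/-- The standard coordinate `t = X₀ / X₁` on the affine line. -/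
def coord : Γ(P1 k, chart k 1) := ratio k 1 0

variable {k}

theorem mem_chart (x : Proj (MvPolynomial.homogeneousSubmodule (Fin 2) k)) : x ∈ chart k 0 ∨ x ∈ chart k 1 := by
  have := Proj.iSup_basicOpen_eq_top' (MvPolynomial.homogeneousSubmodule (Fin 2) k)
    (fun i : Fin 2 => MvPolynomial.X i) (fun i => ⟨1, MvPolynomial.isHomogeneous_X k i⟩) (by
      rw [eq_top_iff]
      intro p _
      induction p using MvPolynomial.induction_on with
      | C a =>
        exact Subalgebra.algebraMap_mem _
          (⟨MvPolynomial.C a, MvPolynomial.isHomogeneous_C _ a⟩ :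
            MvPolynomial.homogeneousSubmodule (Fin 2) k 0)
      | add p q hp hq => exact add_mem (hp trivial) (hq trivial)
      | mul_X p i hp => exact mul_mem (hp trivial) (Algebra.subset_adjoin ⟨i, rfl⟩))
  have hx : x ∈ (⊤ : (P1 k).Opens) := trivial
  rw [← this, Opens.mem_iSup] at hx
  obtain ⟨i, hi⟩ := hx
  fin_cases i
  · exact .inl hi
  · exact .inr hi

/-- The homogeneous prime ideal of a point of the projective line. -/
def primeAt (x : P1 k) : Ideal (MvPolynomial (Fin 2) k) :=
  HomogeneousIdeal.toIdeal (ProjectiveSpectrum.asHomogeneousIdeal x)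

instance (x : P1 k) : (primeAt x).IsPrime := ProjectiveSpectrum.isPrime x

/-- The local ring of a point of the projective line inside the localization of the
homogeneous coordinate ring. -/
def stalkVal (x : P1 k) : (P1 k).presheaf.stalk x →+* Localization.AtPrime (primeAt x) :=
  (algebraMap (HomogeneousLocalization.AtPrime (MvPolynomial.homogeneousSubmodule (Fin 2) k)
    (primeAt x)) (Localization.AtPrime (primeAt x))).comp
    (Proj.stalkIso' (MvPolynomial.homogeneousSubmodule (Fin 2) k) x).toRingHom

theorem stalkVal_injective (x : P1 k) : Function.Injective (stalkVal x) :=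
  (HomogeneousLocalization.val_injective _).comp
    (Proj.stalkIso' (MvPolynomial.homogeneousSubmodule (Fin 2) k) x).injective

theorem stalkVal_germ_ratio (x : P1 k) (i j : Fin 2) (hx : x ∈ chart k i) :
    stalkVal x ((P1 k).presheaf.germ (chart k i) x hx (ratio k i j)) =
      IsLocalization.mk' (M := (primeAt x).primeCompl) _ (MvPolynomial.X j)
        ⟨MvPolynomial.X i, hx⟩ := by
  have h := Proj.stalkIso'_germ (MvPolynomial.homogeneousSubmodule (Fin 2) k) (chart k i) x hx
    (ratio k i j)
  refine (congrArg HomogeneousLocalization.val h).trans ?_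
  have hx' : (MvPolynomial.X i : MvPolynomial (Fin 2) k) ^ 1 ∈ (primeAt x).primeCompl := by
    rwa [pow_one]
  change Localization.mk (MvPolynomial.X j : MvPolynomial (Fin 2) k)
    (⟨MvPolynomial.X i ^ 1, hx'⟩ : (primeAt x).primeCompl) = _
  rw [Localization.mk_eq_mk']
  congr 2
  exact pow_one _

theorem germ_ratio_mul (x : P1 k) (i j : Fin 2) (hi : x ∈ chart k i) (hj : x ∈ chart k j) :
    (P1 k).presheaf.germ (chart k i) x hi (ratio k i j) *
      (P1 k).presheaf.germ (chart k j) x hj (ratio k j i) = 1 := by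
  apply stalkVal_injective x
  rw [map_mul, map_one, stalkVal_germ_ratio, stalkVal_germ_ratio]
  exact IsLocalization.mk'_mul_mk'_eq_one (M := (primeAt x).primeCompl)
    ⟨MvPolynomial.X j, hj⟩ ⟨MvPolynomial.X i, hi⟩

theorem mem_chart_of_isUnit (x : P1 k) (i j : Fin 2) (hi : x ∈ chart k i)
    (h : IsUnit ((P1 k).presheaf.germ (chart k i) x hi (ratio k i j))) : x ∈ chart k j := by
  have h2 := h.map (stalkVal x)
  rw [stalkVal_germ_ratio] at h2
  exact (IsLocalization.AtPrime.isUnit_mk'_iff _ (primeAt x) _ _).mp h2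

end P1

theorem P1.chart_nonempty (k : Type u) [Field k] (i : Fin 2) : ∃ y : P1 k, y ∈ P1.chart k i := by
  have : Nontrivial (Localization.Away (MvPolynomial.X i : MvPolynomial (Fin 2) k)) :=
    (IsLocalization.injective (M := Submonoid.powers (MvPolynomial.X i : MvPolynomial (Fin 2) k)) _
      (powers_le_nonZeroDivisors_of_noZeroDivisors (MvPolynomial.X_ne_zero i))).nontrivial
  have : Nontrivial (HomogeneousLocalization.Away
      (MvPolynomial.homogeneousSubmodule (Fin 2) k) (MvPolynomial.X i)) :=
    ⟨⟨0, 1, fun h => zero_ne_one (α := Localization.Away (MvPolynomial.X i : MvPolynomial (Fin 2) k))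
      (by simpa using congrArg HomogeneousLocalization.val h)⟩⟩
  obtain ⟨y⟩ : Nonempty (Spec (.of (HomogeneousLocalization.Away
      (MvPolynomial.homogeneousSubmodule (Fin 2) k) (MvPolynomial.X i)))) :=
    inferInstanceAs (Nonempty (PrimeSpectrum _))
  have hX : (MvPolynomial.X i : MvPolynomial (Fin 2) k) ∈
    MvPolynomial.homogeneousSubmodule (Fin 2) k 1 := MvPolynomial.isHomogeneous_X k i
  have h : Proj.awayι _ _ hX one_pos y ∈ (Proj.awayι _ _ hX one_pos).opensRange := ⟨y, rfl⟩
  rw [Proj.opensRange_awayι] at h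
  exact ⟨_, h⟩

/-- A smooth proper geometrically connected curve over `k` together with a surjective
`k`-morphism to the projective line. (A smooth curve over a field is projective if and only
if it is proper.) -/
structure CurveOverP1 (k : Type u) [Field k] where
  /-- the curve -/
  X : Scheme.{u}
  /-- its structure morphism -/
  str : X ⟶ Spec (.of k)
  smooth : SmoothOfRelativeDimension 1 str
  proper : IsProper str
  geometricallyConnected : GeometricallyConnected str
  /-- the morphism to the projective line -/
  toP1 : X ⟶ P1 k
  toP1_str : toP1 ≫ P1.str k = str
  surjective : Surjective toP1

namespace CurveOverP1

variable {k : Type u} [Field k] (D : CurveOverP1 k)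

instance : IsIntegral D.X :=
  have := D.smooth
  have := D.proper
  have := D.geometricallyConnected
  isIntegral_of_smooth D.str

instance (x : D.X) : IsDedekindDomain (D.X.presheaf.stalk x) :=
  have := D.smooth
  isDedekindDomain_stalk_of_smooth D.str x

/-- The function field of the curve. -/
abbrev K : Type u := D.X.functionField

/-- The inverse image of the affine line. -/
def Y : D.X.Opens := D.toP1 ⁻¹ᵁ P1.chart k 1

/-- The coordinate `t`, as a regular function on `Y`. -/
def tY : Γ(D.X, D.Y) := D.toP1.app (P1.chart k 1) (P1.coord k)

/-- The set of points of the curve above `∞`. -/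
abbrev Infty : Type u := {z : D.X // z ∉ D.Y}

theorem generic_mem {U : D.X.Opens} {x : D.X} (hx : x ∈ U) : genericPoint D.X ∈ U :=
  ((genericPoint_spec D.X).specializes (Set.mem_univ x)).mem_open U.isOpen hx

theorem generic_mem_Y : genericPoint D.X ∈ D.Y := by
  have := D.surjective
  obtain ⟨y, hy⟩ := P1.chart_nonempty k 1
  obtain ⟨x, hx⟩ := D.toP1.surjective y
  exact D.generic_mem (x := x) (show D.toP1 x ∈ _ from hx ▸ hy)

theorem generic_mem_inf {U : D.X.Opens} {x : D.X} (hx : x ∈ U) : genericPoint D.X ∈ U ⊓ D.Y :=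
  ⟨D.generic_mem hx, D.generic_mem_Y⟩

/-- The germ at the generic point of a function on an open set. -/
def toK (U : D.X.Opens) (hU : genericPoint D.X ∈ U) : Γ(D.X, U) →+* D.K :=
  (D.X.presheaf.germ U (genericPoint D.X) hU).hom

/-- The coordinate `t`, as an element of the function field. -/
def t : D.K := D.toK D.Y D.generic_mem_Y D.tY

/-- The local parameter `1/t` at infinity. -/
theorem exists_inv_t (z : D.Infty) : ∃ s ∈ IsLocalRing.maximalIdeal (D.X.presheaf.stalk z.1),
    algebraMap _ D.K s * D.t = 1 := by
  have hz : D.toP1 z.1 ∈ P1.chart k 0 := (P1.mem_chart _).resolve_right z.2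
  refine ⟨D.toP1.stalkMap z.1 ((P1 k).presheaf.germ _ _ hz (P1.ratio k 0 1)), ?_, ?_⟩
  · intro h
    have := (isUnit_map_iff (D.toP1.stalkMap z.1).hom _).mp h
    exact z.2 (P1.mem_chart_of_isUnit _ 0 1 hz this)
  · have hη : genericPoint D.X ∈ D.toP1 ⁻¹ᵁ P1.chart k 0 := D.generic_mem (x := z.1) hz
    have h := congrArg (D.toP1.stalkMap (genericPoint D.X))
      (P1.germ_ratio_mul _ 0 1 hη D.generic_mem_Y)
    rw [map_mul, map_one] at h
    rw [← h]
    congr 1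
    · have : Nonempty (D.toP1 ⁻¹ᵁ P1.chart k 0) := ⟨⟨_, hη⟩⟩
      refine ((congrArg (algebraMap _ D.K) (Scheme.Hom.germ_stalkMap_apply D.toP1
        (P1.chart k 0) z.1 hz (P1.ratio k 0 1))).trans ?_).trans
        (Scheme.Hom.germ_stalkMap_apply D.toP1 (P1.chart k 0) _ hη (P1.ratio k 0 1)).symm
      exact Scheme.algebraMap_germ_eq_germToFunctionField (X := D.X)
        (U := D.toP1 ⁻¹ᵁ P1.chart k 0) (x := z.1) hz _
    · exact (Scheme.Hom.germ_stalkMap_apply D.toP1 (P1.chart k 1) _ D.generic_mem_Y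
        (P1.ratio k 1 0)).symm

/-- The place of the function field given by a point above `∞`. -/
def place (z : D.Infty) : IsDedekindDomain.HeightOneSpectrum (D.X.presheaf.stalk z.1) where
  asIdeal := IsLocalRing.maximalIdeal _
  isPrime := inferInstance
  ne_bot := by
    obtain ⟨s, hs, h⟩ := D.exists_inv_t z
    intro h0
    rw [h0, Ideal.mem_bot] at hs
    simp [hs] at h

/-- The completion of the function field at a point above `∞`. -/
abbrev Kz (z : D.Infty) : Type u := (D.place z).adicCompletion D.K

end CurveOverP1

section Carlitz

variable {k : Type u} [Field k] [Fintype k]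

/-- The action `c ↦ tc + c ^ q` of `t` on the Carlitz module, for an algebra over `k[t]`. -/
def carlitzMap {R : Type u} [CommRing R] [Algebra k R] (t : R) : R →ₗ[k] R :=
  LinearMap.mulLeft k t + (FiniteField.frobeniusAlgHom k R).toLinearMap

theorem carlitzMap_apply {R : Type u} [CommRing R] [Algebra k R] (t c : R) :
    carlitzMap (k := k) t c = t * c + c ^ Fintype.card k := rfl

/-- The Carlitz module of an algebra over `k` with a distinguished element `t`: the additive
group of the algebra, with `t` acting by `c ↦ tc + c ^ q`. -/
abbrev CarlitzModule (k : Type u) [Field k] [Fintype k] {R : Type u} [CommRing R] [Algebra k R]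
    (t : R) : Type u :=
  Module.AEval' (carlitzMap (k := k) t)

/-- A `k`-algebra with a distinguished element `t` as a module over `k[t]`, with `t` acting by
multiplication. -/
abbrev MulModule (k : Type u) [Field k] {R : Type u} [CommRing R] [Algebra k R] (t : R) : Type u :=
  Module.AEval' (LinearMap.mulLeft k t)

/-- The coefficients `e₀ = 1`, `e₁`, `e₂`, … of the Carlitz exponential
`exp x = ∑ᵢ eᵢ x ^ (q ^ i)`, as elements of a field containing `k(t)`. Comparing coefficients of
`x ^ (q ^ (i + 1))`, the functional equation `exp (tx) = t exp x + (exp x) ^ q` says exactly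
`(t ^ (q ^ (i + 1)) - t) e_{i+1} = eᵢ ^ q`. -/
def carlitzExpCoeff (q : ℕ) {L : Type u} [Field L] (t : L) : ℕ → L
  | 0 => 1
  | i + 1 => carlitzExpCoeff q t i ^ q / (t ^ q ^ (i + 1) - t)

/-- `exp γ = c` in a topological field containing `k[t]`. -/
def HasCarlitzExp (q : ℕ) {L : Type u} [Field L] [TopologicalSpace L] (t γ c : L) : Prop :=
  HasSum (fun i => carlitzExpCoeff q t i * γ ^ q ^ i) c

variable {L : Type u} [Field L] [Algebra k L]

theorem add_pow_card_pow {R : Type u} [CommRing R] [Algebra k R] (x y : R) (i : ℕ) :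
    (x + y) ^ Fintype.card k ^ i = x ^ Fintype.card k ^ i + y ^ Fintype.card k ^ i := by
  induction i with
  | zero => simp
  | succ i ih =>
    simp only [pow_succ, pow_mul, ih]
    exact map_add (FiniteField.frobeniusAlgHom k R) _ _

variable [TopologicalSpace L] [IsTopologicalRing L] {t : L}

theorem HasCarlitzExp.add {γ γ' c c' : L} (h : HasCarlitzExp (Fintype.card k) t γ c)
    (h' : HasCarlitzExp (Fintype.card k) t γ' c') :
    HasCarlitzExp (Fintype.card k) t (γ + γ') (c + c') := by
  have h2 := HasSum.add h h'
  simp only [← mul_add, ← add_pow_card_pow] at h2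
  exact h2

theorem HasCarlitzExp.smul {γ c : L} (a : k) (h : HasCarlitzExp (Fintype.card k) t γ c) :
    HasCarlitzExp (Fintype.card k) t (a • γ) (a • c) := by
  have h2 := HasSum.mul_left (algebraMap k L a) h
  rw [← Algebra.smul_def] at h2
  refine HasSum.congr_fun h2 fun i => ?_
  rw [smul_pow, FiniteField.pow_card_pow, Algebra.smul_def]
  ring

theorem HasCarlitzExp.mul {γ c : L} (ht : ∀ i, t ^ Fintype.card k ^ (i + 1) ≠ t)
    (h : HasCarlitzExp (Fintype.card k) t γ c) :
    HasCarlitzExp (Fintype.card k) t (t * γ) (carlitzMap (k := k) t c) := by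
  have h1 := HasSum.mul_left t h
  have h2 := HasSum.map h (FiniteField.frobeniusAlgHom k L) (continuous_pow (Fintype.card k))
  let b : ℕ → L := fun i => Nat.casesOn i 0 fun j =>
    (carlitzExpCoeff (Fintype.card k) t j * γ ^ Fintype.card k ^ j) ^ Fintype.card k
  have h3 : HasSum b (c ^ Fintype.card k) := by
    have := (hasSum_nat_add_iff (f := b) 1).mp h2
    simpa [b] using this
  refine HasSum.congr_fun (h1.add h3) fun i => ?_
  cases i with
  | zero => simp [b, carlitzExpCoeff]
  | succ i =>
    have hne : t ^ Fintype.card k ^ (i + 1) - t ≠ 0 := sub_ne_zero.mpr (ht i)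
    have he : carlitzExpCoeff (Fintype.card k) t (i + 1) * (t ^ Fintype.card k ^ (i + 1) - t) =
        carlitzExpCoeff (Fintype.card k) t i ^ Fintype.card k := by
      rw [carlitzExpCoeff, div_mul_cancel₀ _ hne]
    simp only [b]
    rw [mul_pow, mul_pow, ← he, ← pow_mul, ← pow_succ]
    ring

end Carlitz

/-- A `k`-linear map commuting with given endomorphisms, as a map of `k[t]`-modules. -/
def aevalMap {k M N : Type u} [Field k] [AddCommGroup M] [Module k M] [AddCommGroup N] [Module k N]
    (φ : M →ₗ[k] M) (ψ : N →ₗ[k] N) (f : M →ₗ[k] N) (h : ∀ m, f (φ m) = ψ (f m)) :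
    Module.AEval' φ →ₗ[k[X]] Module.AEval' ψ :=
  LinearMap.ofAEval φ ((Module.AEval'.of ψ).toLinearMap ∘ₗ f) fun m => by
    simp [Module.AEval.X_smul_of, h]

namespace CurveOverP1

variable {k : Type u} [Field k] (D : CurveOverP1 k)

/-- The constants in the ring of functions on an open set. -/
def scalars (U : D.X.Opens) : k →+* Γ(D.X, U) :=
  (D.str.appLE ⊤ U le_top).hom.comp (Scheme.ΓSpecIso (.of k)).inv.hom

instance (U : D.X.Opens) : Algebra k Γ(D.X, U) := (D.scalars U).toAlgebra

/-- Restriction of functions, as a map of `k`-algebras. -/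
def res {U V : D.X.Opens} (h : V ≤ U) : Γ(D.X, U) →ₐ[k] Γ(D.X, V) where
  __ := (D.X.presheaf.map (homOfLE h).op).hom
  commutes' a := by
    change (D.X.presheaf.map (homOfLE h).op) (D.str.appLE ⊤ U le_top _) = D.str.appLE ⊤ V le_top _
    rw [← Scheme.Hom.appLE_map D.str le_top (homOfLE h).op]
    rfl

theorem res_res {U V W : D.X.Opens} (h : V ≤ U) (h' : W ≤ V) (f : Γ(D.X, U)) :
    D.res h' (D.res h f) = D.res (h'.trans h) f :=
  TopCat.Presheaf.restrict_restrict (F := D.X.presheaf) h' h f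

theorem res_rfl {U : D.X.Opens} (f : Γ(D.X, U)) : D.res le_rfl f = f := by
  change D.X.presheaf.map (𝟙 _) f = f
  rw [D.X.presheaf.map_id]
  rfl

instance : Algebra k D.K :=
  ((D.toK ⊤ trivial).comp (D.scalars ⊤)).toAlgebra

theorem toK_res {U V : D.X.Opens} (h : V ≤ U) (hV : genericPoint D.X ∈ V) (f : Γ(D.X, U)) :
    D.toK V hV (D.res h f) = D.toK U (h hV) f :=
  TopCat.Presheaf.germ_res_apply D.X.presheaf (homOfLE h) _ hV f

theorem toK_algebraMap (U : D.X.Opens) (hU : genericPoint D.X ∈ U) (a : k) :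
    D.toK U hU (algebraMap k _ a) = algebraMap k D.K a := by
  rw [← (D.res (le_top : U ≤ ⊤)).commutes a, toK_res]
  rfl

/-- The function `t` on an open subset of `Y`. -/
def tOn (U : D.X.Opens) : Γ(D.X, U ⊓ D.Y) := D.res inf_le_right D.tY

/-- The element `t` of the completion at a point above `∞`. -/
def tz (z : D.Infty) : D.Kz z := algebraMap D.K (D.Kz z) D.t

/-- The expansion at a point `z` above `∞` of a function on `U ∩ Y`, where `z ∈ U`. -/
def expand (U : D.X.Opens) (z : D.Infty) (hz : z.1 ∈ U) : Γ(D.X, U ⊓ D.Y) →+* D.Kz z :=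
  (algebraMap D.K (D.Kz z)).comp (D.toK (U ⊓ D.Y) (D.generic_mem_inf hz))

theorem expand_res {U V : D.X.Opens} (h : V ≤ U) (z : D.Infty) (hz : z.1 ∈ V)
    (f : Γ(D.X, U ⊓ D.Y)) :
    D.expand V z hz (D.res (inf_le_inf_right _ h) f) = D.expand U z (h hz) f :=
  congrArg (algebraMap D.K (D.Kz z)) (D.toK_res _ _ f)

theorem expand_tOn (U : D.X.Opens) (z : D.Infty) (hz : z.1 ∈ U) :
    D.expand U z hz (D.tOn U) = D.tz z :=
  congrArg (algebraMap D.K (D.Kz z)) (D.toK_res _ _ D.tY)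

theorem expand_algebraMap (U : D.X.Opens) (z : D.Infty) (hz : z.1 ∈ U) (a : k) :
    D.expand U z hz (algebraMap k _ a) = algebraMap k (D.Kz z) a := by
  rw [IsScalarTower.algebraMap_apply k D.K (D.Kz z)]
  exact congrArg (algebraMap D.K (D.Kz z)) (D.toK_algebraMap _ _ a)

theorem t_pow_ne (z : D.Infty) (n : ℕ) (hn : 2 ≤ n) : D.tz z ^ n ≠ D.tz z := by
  intro h
  obtain ⟨s, hs, hst⟩ := D.exists_inv_t z
  rw [tz, ← map_pow] at h
  have h1 : D.t ^ n = D.t := (algebraMap D.K (D.Kz z)).injective h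
  obtain ⟨m, rfl⟩ := Nat.exists_eq_add_of_le hn
  have h2 : algebraMap (D.X.presheaf.stalk z.1) D.K (s ^ (1 + m)) = 1 := by
    have h3 : (algebraMap _ D.K s * D.t) ^ (2 + m) = algebraMap _ D.K s ^ (1 + m) := by
      rw [mul_pow, h1, show 2 + m = (1 + m) + 1 by ring, pow_succ, mul_assoc, hst, mul_one]
    rw [map_pow, ← h3, hst, one_pow]
  have h4 : s ^ (1 + m) = 1 :=
    IsFractionRing.injective (D.X.presheaf.stalk z.1) D.K (by rw [h2, map_one])
  exact hs (IsUnit.of_pow_eq_one h4 (by omega))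

variable [Fintype k]

/-- The Carlitz module `C₀(U ∩ Y)`. -/
abbrev C0 (U : D.X.Opens) : Type u := CarlitzModule k (D.tOn U)

/-- The points of `U` above `∞`. -/
abbrev InftyIn (U : D.X.Opens) : Type u := {z : D.Infty // z.1 ∈ U}

/-- The `A`-module `C₀(U ∩ Y) × ∏ K_z`, where `z` runs over the points of `U` above `∞`. -/
abbrev CAmbient (U : D.X.Opens) : Type u :=
  D.C0 U × ∀ z : D.InftyIn U, MulModule k (D.tz z.1)

/-- The condition `exp γ_z = c` for all points `z` of `U` above `∞`. -/
def IsCSection (U : D.X.Opens) (x : D.CAmbient U) : Prop :=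
  ∀ z : D.InftyIn U, HasCarlitzExp (Fintype.card k) (D.tz z.1)
    ((Module.AEval'.of _).symm (x.2 z)) (D.expand U z.1 z.2 ((Module.AEval'.of _).symm x.1))

theorem isCSection_X_smul {U : D.X.Opens} {x : D.CAmbient U} (hx : D.IsCSection U x) :
    D.IsCSection U ((Polynomial.X : k[X]) • x) := by
  intro z
  have h := (hx z).mul (k := k) fun i => D.t_pow_ne z.1 _ ((Fintype.one_lt_card).trans_le
    (Nat.le_self_pow (Nat.succ_ne_zero i) _))
  have h1 : (Module.AEval'.of _).symm (((Polynomial.X : k[X]) • x).2 z) =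
      D.tz z.1 * (Module.AEval'.of _).symm (x.2 z) := Module.AEval.of_symm_X_smul _ _
  have h2 : (Module.AEval'.of _).symm ((Polynomial.X : k[X]) • x).1 =
      carlitzMap (k := k) (D.tOn U) ((Module.AEval'.of _).symm x.1) :=
    Module.AEval.of_symm_X_smul _ _
  rw [h1, h2]
  convert h using 1
  rw [carlitzMap_apply, carlitzMap_apply, map_add, map_mul, map_pow, expand_tOn]

theorem isCSection_C_smul {U : D.X.Opens} {x : D.CAmbient U} (a : k) (hx : D.IsCSection U x) :
    D.IsCSection U ((Polynomial.C a : k[X]) • x) := by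
  intro z
  have h := (hx z).smul a
  have h1 : (Module.AEval'.of _).symm (((Polynomial.C a : k[X]) • x).2 z) =
      a • (Module.AEval'.of _).symm (x.2 z) :=
    congrArg (Module.AEval'.of _).symm (Module.AEval.C_smul _ a (x.2 z))
  have h2 : (Module.AEval'.of _).symm ((Polynomial.C a : k[X]) • x).1 =
      a • ((Module.AEval'.of _).symm x.1) :=
    congrArg (Module.AEval'.of _).symm (Module.AEval.C_smul _ a x.1)
  rw [h1, h2]
  convert h using 1
  rw [Algebra.smul_def, Algebra.smul_def, map_mul, expand_algebraMap]

theorem isCSection_add {U : D.X.Opens} {x y : D.CAmbient U} (hx : D.IsCSection U x)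
    (hy : D.IsCSection U y) : D.IsCSection U (x + y) := by
  intro z
  have h := (hx z).add (k := k) (hy z)
  rw [← map_add, ← map_add, ← map_add] at h
  exact h

theorem isCSection_zero (U : D.X.Opens) : D.IsCSection U 0 := by
  intro z
  have h : HasCarlitzExp (Fintype.card k) (D.tz z.1) 0 0 := by
    refine HasSum.congr_fun hasSum_zero fun i => ?_
    rw [zero_pow (pow_ne_zero _ Fintype.card_ne_zero), mul_zero]
  simpa using h

/-- The `A`-module `C(U)` of pairs `(c, (γ_z)_z)` with `exp γ_z = c` for all `z`. -/
def CSections (U : D.X.Opens) : Submodule k[X] (D.CAmbient U) where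
  carrier := {x | D.IsCSection U x}
  add_mem' hx hy := D.isCSection_add hx hy
  zero_mem' := D.isCSection_zero U
  smul_mem' p x hx := by
    induction p using Polynomial.induction_on with
    | C a => exact D.isCSection_C_smul a hx
    | add p q hp hq => rw [add_smul]; exact D.isCSection_add hp hq
    | monomial n a h =>
      rw [pow_succ', mul_left_comm, mul_smul]
      exact D.isCSection_X_smul h

/-- Restriction of sections of `C`. -/
def CRes {U V : D.X.Opens} (h : V ≤ U) : D.CSections U →ₗ[k[X]] D.CSections V :=
  LinearMap.restrict (LinearMap.prodMap
    (aevalMap _ _ (D.res (inf_le_inf_right _ h)).toLinearMap fun c => by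
      simp only [carlitzMap_apply, AlgHom.toLinearMap_apply, map_add, map_mul, map_pow]
      congr 2
      exact TopCat.Presheaf.restrict_restrict (F := D.X.presheaf) _ _ D.tY)
    (LinearMap.pi fun z => LinearMap.proj (⟨z.1, h z.2⟩ : D.InftyIn U)))
    fun x hx z => by
      have := hx ⟨z.1, h z.2⟩
      rw [← D.expand_res h z.1 z.2] at this
      exact this

theorem CRes_fst {U V : D.X.Opens} (h : V ≤ U) (x : D.CSections U) :
    (D.CRes h x).1.1 = D.res (inf_le_inf_right _ h) x.1.1 := rfl

theorem CRes_snd {U V : D.X.Opens} (h : V ≤ U) (x : D.CSections U) (z : D.InftyIn V) :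
    (D.CRes h x).1.2 z = x.1.2 ⟨z.1, h z.2⟩ := rfl

/-- The presheaf `C`. -/
def CPresheaf : TopCat.Presheaf (ModuleCat.{u} k[X]) D.X where
  obj U := ModuleCat.of k[X] (D.CSections U.unop)
  map i := ModuleCat.ofHom (D.CRes i.unop.le)
  map_id U := by
    refine ModuleCat.hom_ext (LinearMap.ext fun x => ?_)
    change D.CRes le_rfl x = x
    exact Subtype.ext (Prod.ext (D.res_rfl x.1.1) rfl)
  map_comp i j := by
    refine ModuleCat.hom_ext (LinearMap.ext fun x => ?_)
    change D.CRes (j.unop.le.trans i.unop.le) x = D.CRes j.unop.le (D.CRes i.unop.le x)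
    exact Subtype.ext (Prod.ext (D.res_res (inf_le_inf_right _ i.unop.le)
      (inf_le_inf_right _ j.unop.le) x.1.1).symm rfl)

theorem CPresheaf_isSheaf : D.CPresheaf.IsSheaf := by
  rw [TopCat.Presheaf.isSheaf_iff_isSheaf_comp (forget _)]
  refine TopCat.Presheaf.isSheaf_of_isSheafUniqueGluing_types _ ?_
  intro ι U s hs
  let s' : ∀ i, D.CSections (U i) := s
  have hs' : ∀ i j, D.CRes inf_le_left (s' i) = D.CRes inf_le_right (s' j) := hs
  have hO := (TopCat.Sheaf.existsUnique_gluing' D.X.sheaf (fun i => U i ⊓ D.Y)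
    (iSup U ⊓ D.Y) (fun i => homOfLE (inf_le_inf_right _ (le_iSup U i)))
    (by rw [iSup_inf_eq]) (fun i => (s' i).1.1) ?_)
  · obtain ⟨c, hc, hcu⟩ := hO
    have hc' : ∀ i, D.res (inf_le_inf_right _ (le_iSup U i)) c = (s' i).1.1 := hc
    have hmem : ∀ z : D.InftyIn (iSup U), ∃ i, z.1.1 ∈ U i := fun z => Opens.mem_iSup.mp z.2
    choose idx hidx using hmem
    let γ : ∀ z : D.InftyIn (iSup U), MulModule k (D.tz z.1) :=
      fun z => (s' (idx z)).1.2 ⟨z.1, hidx z⟩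
    have hγ : ∀ i (z : D.InftyIn (U i)), γ ⟨z.1, le_iSup U i z.2⟩ = (s' i).1.2 z := by
      intro i z
      have h := congrArg (fun x => x.1.2 ⟨z.1, ⟨hidx ⟨z.1, le_iSup U i z.2⟩, z.2⟩⟩)
        (hs' (idx ⟨z.1, le_iSup U i z.2⟩) i)
      exact h
    have hsec : D.IsCSection (iSup U) (c, γ) := by
      intro z
      have h := (s' (idx z)).2 ⟨z.1, hidx z⟩
      have h2 : D.expand (U (idx z)) z.1 (hidx z) (s' (idx z)).1.1 = D.expand (iSup U) z.1 z.2 c :=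
        (congrArg (D.expand (U (idx z)) z.1 (hidx z)) (hc' (idx z)).symm).trans
          (D.expand_res (le_iSup U (idx z)) z.1 (hidx z) c)
      exact (congrArg (HasCarlitzExp (Fintype.card k) (D.tz z.1) (γ z)) h2).mp h
    refine ⟨(⟨(c, γ), hsec⟩ : D.CSections (iSup U)), ?_, ?_⟩
    · intro i
      exact Subtype.ext (Prod.ext (hc' i) (funext fun z => hγ i z))
    · intro y hy
      let y' : D.CSections (iSup U) := y
      have hy' : ∀ i, D.CRes (le_iSup U i) y' = s' i := hy
      refine Subtype.ext (Prod.ext (hcu _ fun i => ?_) (funext fun z => ?_))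
      · exact congrArg (fun x => x.1.1) (hy' i)
      · exact congrArg (fun x => x.1.2 ⟨z.1, hidx z⟩) (hy' (idx z))
  · intro i j
    have hle : (U i ⊓ D.Y) ⊓ (U j ⊓ D.Y) ≤ (U i ⊓ U j) ⊓ D.Y :=
      le_inf (inf_le_inf inf_le_left inf_le_left) (inf_le_left.trans inf_le_right)
    have h := congrArg (D.res hle) (congrArg (fun x => x.1.1) (hs' i j))
    exact ((D.res_res (inf_le_inf_right _ inf_le_left) hle (s' i).1.1).symm.trans h).trans
      (D.res_res (inf_le_inf_right _ inf_le_right) hle (s' j).1.1)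

/-- The sheaf `C`. -/
def C : TopCat.Sheaf (ModuleCat.{u} k[X]) D.X := ⟨D.CPresheaf, D.CPresheaf_isSheaf⟩

end CurveOverP1

/-- Extension of scalars `M ↦ A ⊗ M` from `k` to `A = k[t]`. -/
def tensorA (k : Type u) [Field k] : ModuleCat.{u} k ⥤ ModuleCat.{u} k[X] where
  obj M := ModuleCat.of k[X] (k[X] ⊗[k] M)
  map f := ModuleCat.ofHom (f.hom.baseChange k[X])
  map_id M := by
    refine ModuleCat.hom_ext ?_
    simp
  map_comp f g := by
    refine ModuleCat.hom_ext ?_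
    simp [LinearMap.baseChange_comp]

namespace CurveOverP1

variable {k : Type u} [Field k] (D : CurveOverP1 k)

theorem toK_tOn (U : D.X.Opens) (hU : genericPoint D.X ∈ U ⊓ D.Y) : D.toK _ hU (D.tOn U) = D.t :=
  D.toK_res _ _ D.tY

theorem algebraMap_germ {U : D.X.Opens} {x : D.X} (hx : x ∈ U) (f : Γ(D.X, U)) :
    algebraMap (D.X.presheaf.stalk x) D.K (D.X.presheaf.germ U x hx f) =
      D.toK U (D.generic_mem hx) f := by
  have : Nonempty U := ⟨⟨x, hx⟩⟩
  exact Scheme.algebraMap_germ_eq_germToFunctionField (X := D.X) hx f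

/-- The sections over `U` of the sheaf `O_X(n∞)`, the pullback to the curve of the invertible
sheaf of functions on the projective line with a pole of order at most `n` at `∞`. The latter is
trivial on the affine line and generated by `t ^ n` near `∞`, so that sections of the pullback are
functions on `U ∩ Y` that lie in `t ^ n O_{X,z}` for every point `z` of `U` above `∞`. -/
def OInftySections (n : ℤ) (U : D.X.Opens) : Submodule k Γ(D.X, U ⊓ D.Y) where
  carrier := {f | ∀ z : D.InftyIn U, ∃ g : D.X.presheaf.stalk z.1.1,
    D.toK (U ⊓ D.Y) (D.generic_mem_inf z.2) f = D.t ^ n * algebraMap _ D.K g}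
  add_mem' {f f'} hf hf' z := by
    obtain ⟨g, hg⟩ := hf z
    obtain ⟨g', hg'⟩ := hf' z
    exact ⟨g + g', by rw [map_add, map_add, hg, hg', mul_add]⟩
  zero_mem' z := ⟨0, by simp⟩
  smul_mem' a f hf z := by
    obtain ⟨g, hg⟩ := hf z
    refine ⟨D.X.presheaf.germ U z.1.1 z.2 (algebraMap k _ a) * g, ?_⟩
    rw [Algebra.smul_def, map_mul, map_mul, hg, algebraMap_germ, toK_algebraMap, toK_algebraMap]
    ring

/-- Restriction of sections of `O_X(n∞)`. -/
def OInftyRes (n : ℤ) {U V : D.X.Opens} (h : V ≤ U) :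
    D.OInftySections n U →ₗ[k] D.OInftySections n V :=
  LinearMap.restrict (D.res (inf_le_inf_right _ h)).toLinearMap fun f hf z => by
    obtain ⟨g, hg⟩ := hf ⟨z.1, h z.2⟩
    exact ⟨g, (D.toK_res _ _ f).trans hg⟩

/-- The structure sheaf, as a presheaf of `k`-vector spaces. -/
def OX : TopCat.Presheaf (ModuleCat.{u} k) D.X where
  obj U := ModuleCat.of k Γ(D.X, U.unop)
  map i := ModuleCat.ofHom (D.res i.unop.le).toLinearMap
  map_id _ := ModuleCat.hom_ext (LinearMap.ext fun f => D.res_rfl f)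
  map_comp _ _ := ModuleCat.hom_ext (LinearMap.ext fun f => (D.res_res _ _ f).symm)

/-- The sheaf `O_X(n∞)`, as a presheaf of `k`-vector spaces. -/
def OXInfty (n : ℤ) : TopCat.Presheaf (ModuleCat.{u} k) D.X where
  obj U := ModuleCat.of k (D.OInftySections n U.unop)
  map i := ModuleCat.ofHom (D.OInftyRes n i.unop.le)
  map_id _ := ModuleCat.hom_ext (LinearMap.ext fun f => Subtype.ext (D.res_rfl f.1))
  map_comp i j := ModuleCat.hom_ext (LinearMap.ext fun f =>
    Subtype.ext (D.res_res (inf_le_inf_right _ i.unop.le) (inf_le_inf_right _ j.unop.le) f.1).symm)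

/-- The inclusion of `O_X` in `O_X(∞)`. -/
def incl (U : D.X.Opens) : Γ(D.X, U) →ₗ[k] D.OInftySections 1 U :=
  LinearMap.codRestrict _ (D.res inf_le_left).toLinearMap fun f z => by
    obtain ⟨s, -, hs⟩ := D.exists_inv_t z.1
    refine ⟨s * D.X.presheaf.germ U z.1.1 z.2 f, ?_⟩
    rw [map_mul, algebraMap_germ, zpow_one, ← mul_assoc, mul_comm D.t, hs, one_mul]
    exact D.toK_res _ _ f

variable [Fintype k]

/-- The map `f ↦ tf + f ^ q` from `O_X` to `O_X(∞)`. -/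
def carlitzO (U : D.X.Opens) : Γ(D.X, U) →ₗ[k] D.OInftySections 1 U :=
  LinearMap.codRestrict _ (carlitzMap (D.tOn U) ∘ₗ (D.res inf_le_left).toLinearMap) fun f z => by
    obtain ⟨s, -, hs⟩ := D.exists_inv_t z.1
    refine ⟨D.X.presheaf.germ U z.1.1 z.2 f +
      s * D.X.presheaf.germ U z.1.1 z.2 f ^ Fintype.card k, ?_⟩
    rw [LinearMap.comp_apply, carlitzMap_apply, map_add, map_mul, map_pow, toK_tOn,
      AlgHom.toLinearMap_apply, toK_res, map_add, map_mul, map_pow, algebraMap_germ, zpow_one,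
      mul_add, ← mul_assoc, mul_comm D.t (algebraMap _ _ s), hs, one_mul]

/-- The map `∂ : f ⊗ a ↦ f ⊗ ta - (tf + f ^ q) ⊗ a` on sections. -/
def boundarySections (U : D.X.Opens) :
    k[X] ⊗[k] Γ(D.X, U) →ₗ[k[X]] k[X] ⊗[k] D.OInftySections 1 U :=
  (Polynomial.X : k[X]) • (D.incl U).baseChange k[X] - (D.carlitzO U).baseChange k[X]

theorem boundarySections_tmul (U : D.X.Opens) (a : k[X]) (f : Γ(D.X, U)) :
    D.boundarySections U (a ⊗ₜ f) =
      (Polynomial.X * a) ⊗ₜ D.incl U f - a ⊗ₜ D.carlitzO U f := by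
  simp [boundarySections, TensorProduct.smul_tmul']

theorem boundarySections_res {U V : D.X.Opens} (h : V ≤ U) :
    D.boundarySections V ∘ₗ (D.res h).toLinearMap.baseChange k[X] =
      (D.OInftyRes 1 h).baseChange k[X] ∘ₗ D.boundarySections U := by
  refine TensorProduct.AlgebraTensorModule.ext fun a f => ?_
  have h1 : D.incl V (D.res h f) = D.OInftyRes 1 h (D.incl U f) :=
    Subtype.ext ((D.res_res h inf_le_left f).trans
      (D.res_res inf_le_left (inf_le_inf_right _ h) f).symm)
  have h2 : D.carlitzO V (D.res h f) = D.OInftyRes 1 h (D.carlitzO U f) := by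
    refine Subtype.ext ?_
    change carlitzMap (k := k) (D.tOn V) (D.res inf_le_left (D.res h f)) =
      D.res (inf_le_inf_right _ h) (carlitzMap (k := k) (D.tOn U) (D.res inf_le_left f))
    rw [carlitzMap_apply, carlitzMap_apply, map_add, map_mul, map_pow, tOn, tOn, res_res, res_res,
      res_res]
  rw [LinearMap.comp_apply, LinearMap.comp_apply, LinearMap.baseChange_tmul,
    boundarySections_tmul, boundarySections_tmul, map_sub, LinearMap.baseChange_tmul,
    LinearMap.baseChange_tmul, AlgHom.toLinearMap_apply, h1, h2]

/-- The map `∂` of presheaves. -/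
def boundaryPresheaf : D.OX ⋙ tensorA k ⟶ D.OXInfty 1 ⋙ tensorA k where
  app U := ModuleCat.ofHom (D.boundarySections U.unop)
  naturality _ _ i := ModuleCat.hom_ext (D.boundarySections_res i.unop.le)

/-- The sheaf of `A`-modules `F ⊗ A`: the sheaf associated to `U ↦ F(U) ⊗ A`. -/
abbrev sheafTensor (F : TopCat.Presheaf (ModuleCat.{u} k) D.X) :
    TopCat.Sheaf (ModuleCat.{u} k[X]) D.X :=
  (presheafToSheaf (Opens.grothendieckTopology D.X) (ModuleCat.{u} k[X])).obj (F ⋙ tensorA k)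

/-- The map `∂ : O_X ⊗ A ⟶ O_X(∞) ⊗ A` of sheaves of `A`-modules. -/
def boundary : D.sheafTensor D.OX ⟶ D.sheafTensor (D.OXInfty 1) :=
  (presheafToSheaf (Opens.grothendieckTopology D.X) (ModuleCat.{u} k[X])).map D.boundaryPresheaf

end CurveOverP1

end

/-!
Above `∞` the absolute value of `t` exceeds `1`, and there the Carlitz exponential is an isometry
of the disc `|γ| ≤ |t|` with `|exp γ - γ| ≤ |γ / t|`, so it has an inverse `log` on that disc. As a
section `f` of `O_X(∞)` satisfies `|f| ≤ |t|` at every point above `∞`, it defines the section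
`(f, log f)` of `C`; this gives the map `O_X(∞) ⊗ A ⟶ C`.

The map is locally surjective. A section of `C` all of whose `γ_z` lie in the disc is of the form
`(f, log f)`. In general the pole of `γ_z` is lowered one power of `t` at a time: `γ_z / t ^ n` is
approximated up to integral elements by a local section `f` of `O_X(∞)`, hence also by `log f`, and
`t ^ n log f` is the image of `f ⊗ t ^ n`.

The kernel is the image of `∂`. If `∑ i ≤ n, t ^ i log f_i = 0` with `n > 0`, the top term cannot
have a larger pole than the others, so `|f_n| = |log f_n| ≤ 1` and `f_n` is a section of `O_X`;
subtracting `∂ (f_n ⊗ t ^ (n - 1))` lowers the degree, and in degree `0` the map is injective.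
-/

noncomputable section

section ValuedField

open Filter Topology
open Valued (v)

theorem eq_zero_of_forall_valuation_le_pow {L Γ₀ : Type*} [Field L]
    [LinearOrderedCommGroupWithZero Γ₀] [MulArchimedean Γ₀] {w : Valuation L Γ₀} {s c x : L}
    (hs : w s < 1) (h : ∀ i : ℕ, w x ≤ w (s ^ i * c)) : x = 0 := by
  by_contra hx
  have hc : c ≠ 0 := by
    rintro rfl
    exact hx (by simpa using h 0)
  have hxc : w x / w c ≠ 0 := div_ne_zero (w.ne_zero_iff.mpr hx) (w.ne_zero_iff.mpr hc)
  obtain ⟨n, hn⟩ := exists_pow_lt₀ hs (Units.mk0 _ hxc)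
  rw [Units.val_mk0, lt_div_iff₀ (w.pos_iff.mpr hc), ← map_pow, ← map_mul] at hn
  exact (h n).not_gt hn

theorem valuation_top_coeff_le_one {L Γ₀ : Type*} [Field L] [LinearOrderedCommGroupWithZero Γ₀]
    {w : Valuation L Γ₀} {t : L} (ht : 1 < w t) {n : ℕ} {γ : ℕ → L} (hγ : ∀ i, w (γ i) ≤ w t)
    (hsum : ∑ i ∈ Finset.range (n + 2), t ^ i * γ i = 0) : w (γ (n + 1)) ≤ 1 := by
  have hpos : 0 < w t ^ (n + 1) := pow_pos (zero_lt_one.trans ht) _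
  have hlow : w (∑ i ∈ Finset.range (n + 1), t ^ i * γ i) ≤ w t ^ (n + 1) := by
    refine Valuation.map_sum_le w fun i hi => ?_
    calc w (t ^ i * γ i) = w t ^ i * w (γ i) := by rw [map_mul, map_pow]
      _ ≤ w t ^ i * w t := by gcongr; exact hγ i
      _ = w t ^ (i + 1) := (pow_succ _ _).symm
      _ ≤ w t ^ (n + 1) := pow_le_pow_right₀ ht.le (Finset.mem_range.mp hi)
  rw [Finset.sum_range_succ] at hsum
  rw [eq_neg_of_add_eq_zero_left hsum, Valuation.map_neg, map_mul, map_pow] at hlow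
  exact (mul_le_iff_le_one_right hpos).mp hlow

variable {L Γ₀ : Type*} [Field L] [LinearOrderedCommGroupWithZero Γ₀] [Valued L Γ₀]

theorem valuation_le_of_hasSum {ι : Type*} {f : ι → L} {x : L} {r : Γ₀} (h : HasSum f x)
    (hr : ∀ i, v (f i) ≤ r) : v x ≤ r := by
  by_contra! hlt
  obtain ⟨s, hs⟩ := (h.eventually (Valued.locally_const hlt.ne_zero)).exists
  have hs : v (∑ i ∈ s, f i) = v x := hs
  exact (hs ▸ Valuation.map_sum_le v fun i _ => hr i).not_gt hlt

theorem tendsto_zero_of_valuation_le {ι : Type*} {l : Filter ι} {f g : ι → L}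
    (hg : Tendsto g l (𝓝 0)) (h : ∀ i, v (f i) ≤ v (g i)) : Tendsto f l (𝓝 0) := by
  rw [(Valued.hasBasis_nhds_zero L Γ₀).tendsto_right_iff] at hg ⊢
  intro γ hγ
  filter_upwards [hg γ hγ] with i hi
  exact (v.restrict_le_iff.mpr (h i)).trans_lt hi

theorem nonarchimedeanAddGroup_of_valued : NonarchimedeanAddGroup L where
  is_nonarchimedean U hU := by
    obtain ⟨γ, hγ⟩ := Valued.mem_nhds_zero.mp hU
    exact ⟨⟨v.restrict.ltAddSubgroup γ, Valued.isOpen_ball L γ.1⟩, hγ⟩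

variable [MulArchimedean Γ₀] [CompleteSpace L]

theorem summable_of_valuation_le_geometric {f : ℕ → L} {s c : L} (hs : v s < 1)
    (h : ∀ i, v (f i) ≤ v (s ^ i * c)) : Summable f := by
  have hgeom : Tendsto (fun i => s ^ i * c) atTop (𝓝 0) := by
    simpa using (Valued.tendsto_zero_pow_of_v_lt_one hs).mul_const c
  have : NonarchimedeanAddGroup L := nonarchimedeanAddGroup_of_valued
  exact NonarchimedeanAddGroup.summable_of_tendsto_cofinite_zero
    (Nat.cofinite_eq_atTop ▸ tendsto_zero_of_valuation_le hgeom h)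

/- Successive approximation: `δ n = (id - e)^n c` tends to `0` geometrically, and `e` maps the
partial sums of `∑ δ n` to `c - δ n`. -/
theorem exists_map_eq_of_valuation_sub_le {e : L →+ L} {r : Γ₀} {s : L} (hs : v s < 1)
    (he : ∀ x, v x ≤ r → v (e x - x) ≤ v (s * x)) {c : L} (hc : v c ≤ r) :
    ∃ x, v x ≤ r ∧ e x = c := by
  have hmul : ∀ (n : ℕ) (x : L), v (s ^ n * x) ≤ v x := fun n x => by
    rw [map_mul, map_pow]
    exact mul_le_of_le_one_left' (pow_le_one₀ zero_le hs.le)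
  have he' : ∀ x, v x ≤ r → v (e x) ≤ v x := fun x hx => by
    have h := Valuation.map_add_le v ((he x hx).trans (by simpa only [pow_one] using hmul 1 x))
      le_rfl
    rwa [sub_add_cancel] at h
  let δ : ℕ → L := fun n => (fun x => x - e x)^[n] c
  have hδ_succ : ∀ n, δ (n + 1) = δ n - e (δ n) := fun n => Function.iterate_succ_apply' _ _ _
  have hδ : ∀ n, v (δ n) ≤ v (s ^ n * c) := by
    intro n
    induction n with
    | zero => simp [δ]
    | succ n ih =>
      rw [hδ_succ, Valuation.map_sub_swap, pow_succ', mul_assoc]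
      refine (he _ (ih.trans ((hmul n c).trans hc))).trans ?_
      simpa only [map_mul] using mul_le_mul_right ih (v s)
  have hδr : ∀ n, v (δ n) ≤ r := fun n => (hδ n).trans ((hmul n c).trans hc)
  obtain ⟨x, hx⟩ := summable_of_valuation_le_geometric hs hδ
  have hxr : v x ≤ r := valuation_le_of_hasSum hx hδr
  refine ⟨x, hxr, (sub_eq_zero.mp ?_).symm⟩
  refine eq_zero_of_forall_valuation_le_pow (w := v) hs (c := c) fun n => ?_
  have hpartial : e (∑ i ∈ Finset.range n, δ i) = c - δ n := by
    rw [map_sum]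
    refine (Finset.sum_congr rfl fun i _ => ?_).trans (Finset.sum_range_sub' δ n)
    rw [hδ_succ, sub_sub_cancel]
  have htail : v (x - ∑ i ∈ Finset.range n, δ i) ≤ v (s ^ n * c) := by
    refine valuation_le_of_hasSum ((hasSum_nat_add_iff' n).mpr hx) fun i => (hδ _).trans ?_
    rw [pow_add, mul_assoc]
    exact hmul i _
  have hsplit : c - e x = δ n - e (x - ∑ i ∈ Finset.range n, δ i) := by
    rw [map_sub, hpartial]
    ring
  rw [hsplit]
  exact Valuation.map_sub_le v (hδ n) ((he' _ (htail.trans ((hmul n c).trans hc))).trans htail)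

end ValuedField

section CarlitzExp

open Valued (v)

variable {L Γ₀ : Type*} [Field L] [LinearOrderedCommGroupWithZero Γ₀] [Valued L Γ₀] {t : L} {q : ℕ}

theorem valuation_inv_lt_one (ht : 1 < v t) : v t⁻¹ < 1 := by
  rw [map_inv₀]
  exact inv_lt_one_of_one_lt₀ ht

theorem valuation_carlitzExpCoeff (hq : 1 < q) (ht : 1 < v t) (i : ℕ) :
    v (carlitzExpCoeff q t i) = (v t ^ (i * q ^ i))⁻¹ := by
  induction i with
  | zero => simp [carlitzExpCoeff]
  | succ i ih =>
    have hdenom : v (t ^ q ^ (i + 1) - t) = v t ^ q ^ (i + 1) := by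
      rw [← map_pow]
      refine Valuation.map_sub_eq_of_lt_left v ?_
      simpa using pow_lt_pow_right₀ ht (Nat.one_lt_pow (Nat.succ_ne_zero i) hq)
    rw [carlitzExpCoeff, map_div₀, map_pow, ih, hdenom, inv_pow, ← pow_mul, div_eq_mul_inv,
      ← mul_inv, ← pow_add]
    congr 2
    ring

theorem valuation_carlitzExp_term_add_le (hq : 1 < q) (ht : 1 < v t) {γ : L} {m : ℕ}
    (hγ : v γ ≤ v t ^ m) (i : ℕ) :
    v (carlitzExpCoeff q t (i + m) * γ ^ q ^ (i + m)) ≤ v (t⁻¹ ^ i) := by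
  have ht₀ : v t ≠ 0 := ht.ne_zero
  have hle : i + m * q ^ (i + m) ≤ (i + m) * q ^ (i + m) := by
    rw [add_mul]
    gcongr
    exact Nat.le_mul_of_pos_right i (pow_pos (zero_lt_one.trans hq) _)
  rw [map_mul, map_pow, map_pow, map_inv₀, valuation_carlitzExpCoeff hq ht, inv_pow,
    inv_mul_le_iff₀ (pow_pos (zero_lt_iff.mpr ht₀) _), ← div_eq_mul_inv,
    le_div_iff₀ (pow_pos (zero_lt_iff.mpr ht₀) _)]
  calc v γ ^ q ^ (i + m) * v t ^ i
      ≤ (v t ^ m) ^ q ^ (i + m) * v t ^ i := by gcongr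
    _ = v t ^ (i + m * q ^ (i + m)) := by rw [← pow_mul, ← pow_add, add_comm]
    _ ≤ v t ^ ((i + m) * q ^ (i + m)) := pow_le_pow_right₀ ht.le hle

theorem valuation_carlitzExp_term_succ_le (hq : 1 < q) (ht : 1 < v t) {γ : L} (hγ : v γ ≤ v t)
    (i : ℕ) : v (carlitzExpCoeff q t (i + 1) * γ ^ q ^ (i + 1)) ≤ v (t⁻¹ * γ) := by
  obtain ⟨N, hN⟩ : ∃ N, q ^ (i + 1) = N + 1 :=
    Nat.exists_eq_succ_of_ne_zero (pow_pos (zero_lt_one.trans hq) _).ne'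
  have ht₀ : 0 < v t := zero_lt_one.trans ht
  rw [map_mul, map_mul, map_pow, map_inv₀, valuation_carlitzExpCoeff hq ht,
    inv_mul_le_iff₀ (pow_pos ht₀ _), hN]
  calc v γ ^ (N + 1) = v γ ^ N * v γ := pow_succ _ _
    _ ≤ v t ^ N * v γ := by gcongr
    _ = v t ^ (N + 1) * ((v t)⁻¹ * v γ) := by
        rw [pow_succ, mul_assoc, mul_inv_cancel_left₀ ht₀.ne']
    _ ≤ v t ^ ((i + 1) * (N + 1)) * ((v t)⁻¹ * v γ) := by
        gcongr
        · exact ht.le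
        · exact Nat.le_mul_of_pos_left _ i.succ_pos

theorem HasCarlitzExp.valuation_sub_le (hq : 1 < q) (ht : 1 < v t) {γ c : L} (hγ : v γ ≤ v t)
    (h : HasCarlitzExp q t γ c) : v (c - γ) ≤ v (t⁻¹ * γ) := by
  have htail := (hasSum_nat_add_iff' 1).mpr h
  simp only [Finset.sum_range_one, carlitzExpCoeff, pow_zero, pow_one, one_mul] at htail
  exact valuation_le_of_hasSum htail (valuation_carlitzExp_term_succ_le hq ht hγ)

theorem summable_carlitzExp [MulArchimedean Γ₀] [CompleteSpace L] (hq : 1 < q) (ht : 1 < v t)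
    (γ : L) : Summable fun i => carlitzExpCoeff q t i * γ ^ q ^ i := by
  obtain ⟨m, hm⟩ := MulArchimedean.arch (v γ) ht
  refine (summable_nat_add_iff m).mp (summable_of_valuation_le_geometric (c := 1)
    (valuation_inv_lt_one ht) fun i => ?_)
  simpa using valuation_carlitzExp_term_add_le hq ht hm i

end CarlitzExp

section CarlitzLog

open Valued (v)

/-- The disc `|γ| ≤ |t|`, on which the Carlitz exponential is an isometry. -/
def carlitzDisc (k : Type*) [Field k] [Finite k] {L Γ₀ : Type*} [Field L] [Algebra k L]
    [LinearOrderedCommGroupWithZero Γ₀] [Valued L Γ₀] (t : L) : Submodule k L where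
  __ := v.leAddSubgroup (v t)
  smul_mem' a γ hγ := by
    change v (a • γ) ≤ v t
    rw [Algebra.smul_def, map_mul]
    exact (mul_le_of_le_one_left' (FiniteField.valuation_algebraMap_le_one v a)).trans hγ

variable {k : Type u} [Field k] [Fintype k] {L : Type u} [Field L] [Algebra k L]
  {Γ₀ : Type*} [LinearOrderedCommGroupWithZero Γ₀] [Valued L Γ₀]

variable [MulArchimedean Γ₀] [CompleteSpace L] {t : L}

variable (k) in
/-- The Carlitz exponential of a complete valued field with `1 < |t|`, on which it converges
everywhere. -/
def carlitzExp (ht : 1 < v t) : L →ₗ[k] L :=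
  have h (γ : L) : HasCarlitzExp (Fintype.card k) t γ
      (∑' i, carlitzExpCoeff (Fintype.card k) t i * γ ^ Fintype.card k ^ i) :=
    (summable_carlitzExp Fintype.one_lt_card ht γ).hasSum
  { toFun γ := ∑' i, carlitzExpCoeff (Fintype.card k) t i * γ ^ Fintype.card k ^ i
    map_add' γ γ' := ((h γ).add (h γ')).tsum_eq
    map_smul' a γ := ((h γ).smul a).tsum_eq }

theorem hasCarlitzExp_iff (ht : 1 < v t) {γ c : L} :
    HasCarlitzExp (Fintype.card k) t γ c ↔ carlitzExp k ht γ = c :=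
  (summable_carlitzExp Fintype.one_lt_card ht γ).hasSum_iff

theorem hasCarlitzExp_carlitzExp (ht : 1 < v t) (γ : L) :
    HasCarlitzExp (Fintype.card k) t γ (carlitzExp k ht γ) :=
  (hasCarlitzExp_iff ht).mpr rfl

theorem carlitzExp_mul (ht : 1 < v t) (γ : L) :
    carlitzExp k ht (t * γ) = carlitzMap (k := k) t (carlitzExp k ht γ) := by
  refine (hasCarlitzExp_iff ht).mp ((hasCarlitzExp_carlitzExp ht γ).mul (k := k) fun i h => ?_)
  have hlt : v t < v t ^ Fintype.card k ^ (i + 1) :=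
    lt_self_pow₀ ht (Nat.one_lt_pow i.succ_ne_zero Fintype.one_lt_card)
  rw [← map_pow, h] at hlt
  exact hlt.false

theorem valuation_carlitzExp_sub_le (ht : 1 < v t) {γ : L} (hγ : v γ ≤ v t) :
    v (carlitzExp k ht γ - γ) ≤ v (t⁻¹ * γ) :=
  (hasCarlitzExp_carlitzExp ht γ).valuation_sub_le Fintype.one_lt_card ht hγ

theorem valuation_carlitzExp (ht : 1 < v t) {γ : L} (hγ : v γ ≤ v t) :
    v (carlitzExp k ht γ) = v γ := by
  rcases eq_or_ne γ 0 with rfl | hγ₀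
  · rw [map_zero]
  refine Valuation.map_eq_of_sub_lt v ((valuation_carlitzExp_sub_le ht hγ).trans_lt ?_)
  rw [map_mul]
  exact mul_lt_of_lt_one_left (v.pos_iff.mpr hγ₀) (valuation_inv_lt_one ht)

theorem bijective_restrict_carlitzExp (ht : 1 < v t) :
    Function.Bijective ((carlitzExp k ht).restrict (p := carlitzDisc k t) (q := carlitzDisc k t)
      fun _ hγ => (valuation_carlitzExp ht hγ).trans_le hγ) := by
  refine ⟨(injective_iff_map_eq_zero _).mpr fun γ hγ => ?_, fun c => ?_⟩
  · have hexp : carlitzExp k ht γ = 0 := congrArg Subtype.val hγ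
    rw [← ZeroMemClass.coe_eq_zero, ← (v (R := L)).zero_iff,
      ← valuation_carlitzExp (k := k) ht γ.2, hexp, map_zero]
  · obtain ⟨γ, hγ, hexp⟩ := exists_map_eq_of_valuation_sub_le
      (e := (carlitzExp k ht).toAddMonoidHom) (valuation_inv_lt_one ht)
      (fun _ => valuation_carlitzExp_sub_le (k := k) ht) c.2
    exact ⟨⟨γ, hγ⟩, Subtype.ext hexp⟩

variable (k) in
/-- The Carlitz logarithm: the inverse of the Carlitz exponential on the disc `|γ| ≤ |t|`. -/
def carlitzLog (ht : 1 < v t) : carlitzDisc k t ≃ₗ[k] carlitzDisc k t :=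
  (LinearEquiv.ofBijective _ (bijective_restrict_carlitzExp ht)).symm

theorem carlitzExp_carlitzLog (ht : 1 < v t) (c : carlitzDisc k t) :
    carlitzExp k ht (carlitzLog k ht c) = c :=
  congrArg Subtype.val
    (LinearEquiv.apply_ofBijective_symm_apply _ (h := bijective_restrict_carlitzExp ht) c)

theorem carlitzLog_eq_of_carlitzExp_eq (ht : 1 < v t) {γ c : carlitzDisc k t}
    (h : carlitzExp k ht γ = c) : carlitzLog k ht c = γ :=
  (LinearEquiv.symm_apply_eq _).mpr (Subtype.ext h.symm)

theorem valuation_carlitzLog (ht : 1 < v t) (c : carlitzDisc k t) :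
    v (carlitzLog k ht c : L) = v (c : L) := by
  rw [← valuation_carlitzExp (k := k) ht (carlitzLog k ht c).2, carlitzExp_carlitzLog]

theorem valuation_sub_carlitzLog_le_one (ht : 1 < v t) (c : carlitzDisc k t) :
    v (c - carlitzLog k ht c : L) ≤ 1 := by
  have h := valuation_carlitzExp_sub_le (k := k) ht (carlitzLog k ht c).2
  rw [carlitzExp_carlitzLog] at h
  refine h.trans ?_
  rw [map_mul, map_inv₀]
  exact inv_mul_le_one_of_le₀ (carlitzLog k ht c).2 zero_le

end CarlitzLog

section Sheafification

theorem exact_of_exact_evaluation {C A : Type*} [Category C] [Category A] [Abelian A]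
    (S : ShortComplex (C ⥤ A)) (h : ∀ X, (S.map ((evaluation C A).obj X)).Exact) : S.Exact := by
  rw [ShortComplex.exact_iff_isZero_homology, Functor.isZero_iff]
  exact fun X => ((ShortComplex.exact_iff_isZero_homology _).mp (h X)).of_iso
    (S.mapHomologyIso ((evaluation C A).obj X)).symm

theorem exists_shortExact_presheafToSheaf {C : Type u} [SmallCategory C]
    {J : GrothendieckTopology C} {R : Type u} [CommRing R] {P Q : Cᵒᵖ ⥤ ModuleCat.{u} R}
    {F : Sheaf J (ModuleCat.{u} R)} {f : P ⟶ Q} {g : Q ⟶ F.obj}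
    (hf : ∀ U, Function.Injective (f.app U).hom)
    (hfg : ∀ U, Function.Exact (f.app U).hom (g.app U).hom)
    (hg : Presheaf.IsLocallySurjective J g) :
    ∃ (π : (presheafToSheaf J _).obj Q ⟶ F) (w : (presheafToSheaf J _).map f ≫ π = 0),
      (ShortComplex.mk ((presheafToSheaf J _).map f) π w).ShortExact := by
  let a := presheafToSheaf J (ModuleCat.{u} R)
  let ε := (sheafificationAdjunction J (ModuleCat.{u} R)).counit.app F
  have hε : IsIso ε := isIso_sheafificationAdjunction_counit F
  have hw : f ≫ g = 0 := by
    ext U x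
    exact (hfg U).apply_apply_eq_zero x
  have hexact : ((ShortComplex.mk f g hw).map a).Exact :=
    (exact_of_exact_evaluation (ShortComplex.mk f g hw) fun U => by
      rw [ShortComplex.moduleCat_exact_iff]
      exact fun x hx => (hfg U x).mp hx).map a
  have : Mono f :=
    have (U : Cᵒᵖ) : Mono (f.app U) := (ModuleCat.mono_iff_injective _).mpr (hf U)
    NatTrans.mono_of_mono_app f
  have : Epi (a.map g) :=
    have : Sheaf.IsLocallySurjective (a.map g) :=
      (Presheaf.isLocallySurjective_presheafToSheaf_map_iff _ g).mpr hg
    inferInstance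
  have w : a.map f ≫ a.map g ≫ ε = 0 := by
    rw [← Category.assoc, ← a.map_comp, hw, Functor.map_zero, Limits.zero_comp]
  let e : (ShortComplex.mk f g hw).map a ≅ ShortComplex.mk (a.map f) (a.map g ≫ ε) w :=
    ShortComplex.isoMk (Iso.refl _) (Iso.refl _) (@asIso _ _ _ _ ε hε)
      ((Category.id_comp _).trans (Category.comp_id _).symm) (Category.id_comp _)
  exact ⟨a.map g ≫ ε, w,
    { exact := (ShortComplex.exact_iff_of_iso e).mp hexact
      mono_f := inferInstanceAs (Mono (a.map f))
      epi_g := inferInstanceAs (Epi (a.map g ≫ ε)) }⟩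

end Sheafification

namespace PolynomialTensor

open Polynomial (X)

theorem liftBaseChange_baseChange {R A M N P Q : Type*} [CommRing R] [CommRing A]
    [Algebra R A] [AddCommGroup M] [Module R M] [AddCommGroup N] [Module R N] [AddCommGroup P]
    [Module R P] [Module A P] [IsScalarTower R A P] [AddCommGroup Q] [Module R Q] [Module A Q]
    [IsScalarTower R A Q] {π : M →ₗ[R] P} {ϖ : N →ₗ[R] Q} {ρ : M →ₗ[R] N} {σ : P →ₗ[A] Q}
    (h : ∀ m, ϖ (ρ m) = σ (π m)) (x : A ⊗[R] M) :
    ϖ.liftBaseChange A (ρ.baseChange A x) = σ (π.liftBaseChange A x) := by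
  induction x with
  | zero => simp only [map_zero]
  | add x y hx hy => simp only [map_add, hx, hy]
  | tmul a m => simp [h]

variable {R M N P : Type*} [CommRing R] [AddCommGroup M] [Module R M] [AddCommGroup N] [Module R N]

theorem exists_eq_sum_X_pow_tmul (x : R[X] ⊗[R] M) :
    ∃ (n : ℕ) (f : ℕ → M), x = ∑ i ∈ Finset.range n, ((X : R[X]) ^ i) ⊗ₜ f i := by
  obtain ⟨f, rfl⟩ :=
    (TensorProduct.equivFinsuppOfBasisLeft (N := M) (Polynomial.basisMonomials R)).symm.surjective x
  refine ⟨f.support.sup id + 1, f, ?_⟩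
  rw [TensorProduct.equivFinsuppOfBasisLeft_symm_apply, Finsupp.sum_of_support_subset f
    (Finset.subset_range_sup_succ _) _ fun _ _ => TensorProduct.tmul_zero _ _]
  simp only [Polynomial.coe_basisMonomials, Polynomial.X_pow_eq_monomial]

/-- The coefficient of `X ^ n` of a polynomial with coefficients in `M`. -/
def coeff (n : ℕ) : R[X] ⊗[R] M →ₗ[R] M :=
  TensorProduct.lid R M ∘ₗ (Polynomial.lcoeff R n).rTensor M

theorem coeff_X_pow_tmul (n i : ℕ) (m : M) :
    coeff n (((X : R[X]) ^ i) ⊗ₜ[R] m) = if n = i then m else 0 := by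
  simp [coeff, Polynomial.coeff_X_pow]

/-- The map `a ⊗ m ↦ Xa ⊗ ι m - a ⊗ φ m`. -/
def boundary (ι φ : M →ₗ[R] N) : R[X] ⊗[R] M →ₗ[R[X]] R[X] ⊗[R] N :=
  (X : R[X]) • ι.baseChange R[X] - φ.baseChange R[X]

theorem boundary_tmul (ι φ : M →ₗ[R] N) (a : R[X]) (m : M) :
    boundary ι φ (a ⊗ₜ m) = (X * a) ⊗ₜ ι m - a ⊗ₜ φ m := by
  simp [boundary, TensorProduct.smul_tmul']

theorem boundary_X_pow_tmul (ι φ : M →ₗ[R] N) (n : ℕ) (m : M) :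
    boundary ι φ ((X ^ n) ⊗ₜ m) = (X ^ (n + 1)) ⊗ₜ ι m - (X ^ n) ⊗ₜ φ m := by
  rw [boundary_tmul, pow_succ']

theorem boundary_injective {ι : M →ₗ[R] N} (hι : Function.Injective ι) (φ : M →ₗ[R] N) :
    Function.Injective (boundary ι φ) := by
  refine (injective_iff_map_eq_zero _).mpr fun x hx => ?_
  obtain ⟨n, f, rfl⟩ := exists_eq_sum_X_pow_tmul x
  induction n with
  | zero => rw [Finset.sum_range_zero]
  | succ n ih =>
    have htop : f n = 0 := by
      refine hι ?_
      simpa [boundary_X_pow_tmul, coeff_X_pow_tmul] using congrArg (coeff (n + 1)) hx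
    rw [Finset.sum_range_succ, htop, TensorProduct.tmul_zero, add_zero] at hx ⊢
    exact ih hx

theorem exists_sum_X_pow_tmul_add_boundary {ι : M →ₗ[R] N} (φ : M →ₗ[R] N) {n : ℕ} {f : ℕ → N}
    {m : M} (hm : ι m = f (n + 1)) :
    ∃ g : ℕ → N, ∑ i ∈ Finset.range (n + 2), (X ^ i) ⊗ₜ f i =
      ∑ i ∈ Finset.range (n + 1), (X ^ i) ⊗ₜ g i + boundary ι φ ((X ^ n) ⊗ₜ m) := by
  refine ⟨Function.update f n (f n + φ m), ?_⟩
  have hlow : ∑ i ∈ Finset.range n, (X ^ i) ⊗ₜ[R] Function.update f n (f n + φ m) i =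
      ∑ i ∈ Finset.range n, ((X : R[X]) ^ i) ⊗ₜ[R] f i :=
    Finset.sum_congr rfl fun i hi => by rw [Function.update_of_ne (Finset.mem_range.mp hi).ne]
  rw [boundary_X_pow_tmul, hm, Finset.sum_range_succ, Finset.sum_range_succ, Finset.sum_range_succ,
    hlow, Function.update_self, TensorProduct.tmul_add]
  abel

variable [AddCommGroup P] [Module R P] [Module R[X] P] [IsScalarTower R R[X] P]

theorem exact_boundary_liftBaseChange {ι φ : M →ₗ[R] N} {π : N →ₗ[R] P}
    (hπ : ∀ m, (X : R[X]) • π (ι m) = π (φ m)) (hinj : Function.Injective π)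
    (htop : ∀ (n : ℕ) (f : ℕ → N), ∑ i ∈ Finset.range (n + 2), (X : R[X]) ^ i • π (f i) = 0 →
      f (n + 1) ∈ LinearMap.range ι) :
    Function.Exact (boundary ι φ) (π.liftBaseChange R[X]) := by
  have hcomp : π.liftBaseChange R[X] ∘ₗ boundary ι φ = 0 := by
    ext m
    simp [boundary_tmul, hπ]
  refine LinearMap.exact_of_comp_eq_zero_of_ker_le_range hcomp fun x hx => ?_
  rw [LinearMap.mem_ker] at hx
  obtain ⟨n, f, rfl⟩ := exists_eq_sum_X_pow_tmul x
  induction n generalizing f with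
  | zero => exact ⟨0, by simp⟩
  | succ n ih =>
    rcases n with _ | n
    · have h₀ : f 0 = 0 := (map_eq_zero_iff π hinj).mp (by simpa using hx)
      exact ⟨0, by simp [h₀]⟩
    · obtain ⟨m, hm⟩ := htop n f (by simpa using hx)
      obtain ⟨g, hg⟩ := exists_sum_X_pow_tmul_add_boundary φ hm
      rw [hg] at hx ⊢
      have hb : π.liftBaseChange R[X] (boundary ι φ ((X ^ n) ⊗ₜ m)) = 0 :=
        LinearMap.congr_fun hcomp ((X ^ n) ⊗ₜ m)
      rw [map_add, hb, add_zero] at hx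
      exact add_mem (ih g hx) ⟨_, rfl⟩

end PolynomialTensor

theorem MulModule.of_symm_X_pow_smul {k R : Type u} [Field k] [CommRing R] [Algebra k R] (t : R)
    (n : ℕ) (m : MulModule k t) :
    (Module.AEval'.of (LinearMap.mulLeft k t)).symm ((Polynomial.X : k[X]) ^ n • m) =
      t ^ n * (Module.AEval'.of (LinearMap.mulLeft k t)).symm m := by
  rw [Module.AEval.of_symm_smul, map_pow, Polynomial.aeval_X, LinearMap.pow_mulLeft,
    Module.End.smul_def, LinearMap.mulLeft_apply]

section PointsOfCurves

theorem finite_of_noetherianSpace_of_t1Space {α : Type*} [TopologicalSpace α] [NoetherianSpace α]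
    [QuasiSober α] [T1Space α] : Finite α := by
  have : Finite (irreducibleComponents α) := NoetherianSpace.finite_irreducibleComponents
  refine Finite.of_injective (β := irreducibleComponents α)
    (fun x => ⟨irreducibleComponent x, irreducibleComponent_mem_irreducibleComponents x⟩)
    fun x y hxy => ?_
  have hsub (x : α) : (irreducibleComponent x).Subsingleton := by
    obtain ⟨η, hη⟩ := QuasiSober.sober (isIrreducible_irreducibleComponent (x := x))
      isClosed_irreducibleComponent
    rw [← hη.def, closure_singleton]
    exact Set.subsingleton_singleton
  have hxy' : irreducibleComponent x = irreducibleComponent y := congrArg Subtype.val hxy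
  exact hsub y (hxy' ▸ mem_irreducibleComponent) mem_irreducibleComponent

theorem eq_genericPoint_or_eq_of_specializes {X : Scheme.{u}} [IsIntegral X] {x y : X}
    [Ring.DimensionLEOne (X.presheaf.stalk x)] (h : y ⤳ x) : y = genericPoint X ∨ y = x := by
  have hrange {w : X} (hw : w ⤳ x) : ∃ p, X.fromSpecStalk x p = w := by
    have : w ∈ Set.range (X.fromSpecStalk x) := Scheme.range_fromSpecStalk (X := X) ▸ hw
    exact this
  have hgen (w : X) : genericPoint X ⤳ w := (genericPoint_spec X).specializes (Set.mem_univ w)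
  obtain ⟨p, rfl⟩ := hrange h
  by_cases hp : p.asIdeal = ⊥
  · obtain ⟨η, hη⟩ := hrange (hgen x)
    have hpη : p ⤳ η := (PrimeSpectrum.le_iff_specializes p η).mp
      (show p.asIdeal ≤ η.asIdeal from hp ▸ bot_le)
    left
    exact (hη ▸ hpη.map (X.fromSpecStalk x).continuous).antisymm (hgen _) |>.eq
  · have hmax : p = IsLocalRing.closedPoint (X.presheaf.stalk x) :=
      PrimeSpectrum.ext (IsLocalRing.eq_maximalIdeal (p.isPrime.isMaximal hp))
    right
    rw [hmax]
    exact Scheme.fromSpecStalk_closedPoint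

end PointsOfCurves

namespace CurveOverP1

variable {k : Type u} [Field k] (D : CurveOverP1 k)

instance : NoetherianSpace D.X := by
  have := D.smooth
  have := D.proper
  have : IsLocallyNoetherian D.X := LocallyOfFiniteType.isLocallyNoetherian D.str
  have : CompactSpace D.X := QuasiCompact.compactSpace_of_compactSpace D.str
  have : IsNoetherian D.X := {}
  infer_instance

instance : T1Space D.Infty :=
  t1Space_iff_specializes_imp_eq.mpr fun w _ h => Subtype.ext
    ((eq_genericPoint_or_eq_of_specializes (h.map continuous_subtype_val)).resolve_left
      fun hw => w.2 (hw ▸ D.generic_mem_Y))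

instance : Finite D.Infty :=
  have : QuasiSober D.Infty := D.Y.isOpen.isClosed_compl.isClosedEmbedding_subtypeVal.quasiSober
  have : NoetherianSpace D.Infty := NoetherianSpace.set (α := D.X) (D.Y : Set D.X)ᶜ
  finite_of_noetherianSpace_of_t1Space

theorem exists_opens_infty_eq (z : D.Infty) :
    ∃ U : D.X.Opens, z.1 ∈ U ∧ ∀ w : D.Infty, w.1 ∈ U → w = z := by
  obtain ⟨U, hU, hUz⟩ := isOpen_induced_iff.mp (isOpen_discrete {z})
  exact ⟨⟨U, hU⟩, hUz.ge rfl, fun w hw => hUz.le hw⟩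

theorem eq_of_toK_eq {U : D.X.Opens} {f g : Γ(D.X, U)} (h : ∀ hU, D.toK U hU f = D.toK U hU g) :
    f = g := by
  by_cases hU : genericPoint D.X ∈ U
  · have : Nonempty U := ⟨⟨_, hU⟩⟩
    exact Scheme.germToFunctionField_injective D.X U (h hU)
  · obtain rfl : U = ⊥ := le_bot_iff.mp fun x hx => hU (D.generic_mem hx)
    exact Subsingleton.elim f g

theorem exists_toK_eq_of_algebraMap_eq {x : D.X} {y : D.K} {g : D.X.presheaf.stalk x}
    (hg : algebraMap _ D.K g = y) :
    ∃ (V : D.X.Opens) (hx : x ∈ V) (G : Γ(D.X, V)), D.toK V (D.generic_mem hx) G = y := by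
  obtain ⟨V, hx, G, rfl⟩ := D.X.presheaf.exists_germ_eq g
  exact ⟨V, hx, G, (D.algebraMap_germ hx G).symm.trans hg⟩

theorem exists_toK_eq {U : D.X.Opens} {y : D.K}
    (hy : ∀ x ∈ U, ∃ g : D.X.presheaf.stalk x, algebraMap _ D.K g = y) :
    ∃ F : Γ(D.X, U), ∀ hU, D.toK U hU F = y := by
  have hloc (x : U) : ∃ (V : D.X.Opens) (_ : V ≤ U) (_ : x.1 ∈ V) (G : Γ(D.X, V)),
      ∀ hV, D.toK V hV G = y := by
    obtain ⟨g, hg⟩ := hy x x.2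
    obtain ⟨V, hxV, G, hG⟩ := D.exists_toK_eq_of_algebraMap_eq hg
    exact ⟨V ⊓ U, inf_le_right, ⟨hxV, x.2⟩, D.res inf_le_left G, fun hV => by rw [toK_res, hG]⟩
  choose V hVU hxV G hG using hloc
  obtain ⟨F, hF, -⟩ := TopCat.Sheaf.existsUnique_gluing' D.X.sheaf V U (fun x => homOfLE (hVU x))
    (fun x hx => Opens.mem_iSup.mpr ⟨⟨x, hx⟩, hxV ⟨x, hx⟩⟩) G fun x x' => by
      refine D.eq_of_toK_eq fun hη => ?_
      change D.toK _ hη (D.res inf_le_left (G x)) = D.toK _ hη (D.res inf_le_right (G x'))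
      rw [toK_res, toK_res, hG, hG]
  refine ⟨F, fun hU => ?_⟩
  have hη : genericPoint D.X ∈ V ⟨_, hU⟩ := hxV _
  calc D.toK U hU F = D.toK _ hη (D.res (hVU _) F) := (D.toK_res (hVU _) hη F).symm
    _ = D.toK _ hη (G ⟨_, hU⟩) := congrArg (D.toK _ hη) (hF _)
    _ = y := hG _ hη

section Places

theorem valued_algebraMap (z : D.Infty) (x : D.K) :
    Valued.v (algebraMap D.K (D.Kz z) x) = (D.place z).valuation D.K x := by
  rw [← IsDedekindDomain.HeightOneSpectrum.adicCompletion.valued_coe]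
  rfl

theorem valued_algebraMap_le_one_iff (z : D.Infty) (x : D.K) :
    Valued.v (algebraMap D.K (D.Kz z) x) ≤ 1 ↔
      ∃ g : D.X.presheaf.stalk z.1, algebraMap _ D.K g = x := by
  rw [valued_algebraMap]
  refine ⟨fun h => IsDedekindDomain.HeightOneSpectrum.mem_integers_of_valuation_le_one D.K x
    fun v => ?_, ?_⟩
  · obtain rfl : v = D.place z :=
      IsDedekindDomain.HeightOneSpectrum.ext (IsLocalRing.eq_maximalIdeal v.isMaximal)
    exact h
  · rintro ⟨g, rfl⟩
    exact IsDedekindDomain.HeightOneSpectrum.valuation_le_one _ _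

theorem one_lt_valued_tz (z : D.Infty) : 1 < Valued.v (D.tz z) := by
  obtain ⟨s, hs, hst⟩ := D.exists_inv_t z
  have hs' : (D.place z).valuation D.K (algebraMap _ D.K s) < 1 :=
    (IsDedekindDomain.HeightOneSpectrum.valuation_lt_one_iff_mem _ _).mpr hs
  have hmul : (D.place z).valuation D.K (algebraMap _ D.K s) *
      (D.place z).valuation D.K D.t = 1 := by
    rw [← map_mul, hst, map_one]
  rw [tz, valued_algebraMap]
  by_contra! ht
  exact absurd hmul (mul_lt_one_of_lt_of_le hs' ht).ne

theorem t_ne_zero (z : D.Infty) : D.t ≠ 0 := by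
  obtain ⟨s, -, hst⟩ := D.exists_inv_t z
  exact right_ne_zero_of_mul_eq_one hst

theorem valued_algebraMap_le_valued_tz_iff (z : D.Infty) (x : D.K) :
    Valued.v (algebraMap D.K (D.Kz z) x) ≤ Valued.v (D.tz z) ↔
      ∃ g : D.X.presheaf.stalk z.1, x = D.t * algebraMap _ D.K g := by
  rw [← div_le_one₀ (zero_lt_one.trans (D.one_lt_valued_tz z)), tz, ← map_div₀, ← map_div₀,
    valued_algebraMap_le_one_iff]
  refine exists_congr fun g => ?_
  rw [eq_div_iff (D.t_ne_zero z), mul_comm, eq_comm]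

theorem mem_OInftySections_one_iff {U : D.X.Opens} {f : Γ(D.X, U ⊓ D.Y)} :
    f ∈ D.OInftySections 1 U ↔
      ∀ z : D.InftyIn U, Valued.v (D.expand U z.1 z.2 f) ≤ Valued.v (D.tz z.1) :=
  forall_congr' fun z => by
    simp only [zpow_one]
    exact (D.valued_algebraMap_le_valued_tz_iff z.1 _).symm

theorem mem_range_incl_iff {U : D.X.Opens} {f : D.OInftySections 1 U} :
    f ∈ LinearMap.range (D.incl U) ↔
      ∀ z : D.InftyIn U, Valued.v (D.expand U z.1 z.2 f.1) ≤ 1 := by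
  constructor
  · rintro ⟨F, rfl⟩ z
    refine (D.valued_algebraMap_le_one_iff z.1 _).mpr ⟨D.X.presheaf.germ U z.1.1 z.2 F, ?_⟩
    rw [algebraMap_germ]
    exact (D.toK_res inf_le_left (D.generic_mem_inf z.2) F).symm
  · intro hf
    by_cases hη : genericPoint D.X ∈ U ⊓ D.Y
    · obtain ⟨F, hF⟩ := D.exists_toK_eq (U := U) (y := D.toK _ hη f.1) fun x hx => by
        by_cases hxY : x ∈ D.Y
        · exact ⟨_, D.algebraMap_germ (U := U ⊓ D.Y) ⟨hx, hxY⟩ f.1⟩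
        · exact (D.valued_algebraMap_le_one_iff ⟨x, hxY⟩ _).mp (hf ⟨⟨x, hxY⟩, hx⟩)
      exact ⟨F, Subtype.ext (D.eq_of_toK_eq fun hη' => (D.toK_res _ hη' F).trans (hF hη'.1))⟩
    · exact ⟨0, Subtype.ext (D.eq_of_toK_eq fun hη' => absurd hη' hη)⟩

theorem incl_injective (U : D.X.Opens) : Function.Injective (D.incl U) := fun f g h =>
  D.eq_of_toK_eq fun hU => by
    have hη : genericPoint D.X ∈ U ⊓ D.Y := ⟨hU, D.generic_mem_Y⟩
    have hres : D.res inf_le_left f = D.res inf_le_left g := congrArg Subtype.val h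
    rw [← D.toK_res inf_le_left hη, hres, toK_res]

theorem exists_valued_sub_algebraMap_le_one (z : D.Infty) (y : D.Kz z) :
    ∃ a : D.K, Valued.v (y - algebraMap D.K (D.Kz z) a) ≤ 1 := by
  have hopen : IsOpen {x : D.Kz z | Valued.v (y - x) ≤ 1} :=
    (Valued.isOpen_integer (D.Kz z)).preimage (continuous_const.sub continuous_id)
  exact (IsDedekindDomain.HeightOneSpectrum.denseRange_algebraMap D.K
    (D.place z)).exists_mem_open hopen ⟨y, by simp⟩

theorem exists_OInftySections_expand_eq {U : D.X.Opens} (z : D.InftyIn U) {a : D.K}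
    (ha : Valued.v (algebraMap D.K (D.Kz z.1) a) ≤ Valued.v (D.tz z.1)) :
    ∃ (V : D.X.Opens) (_ : V ≤ U) (hz : z.1.1 ∈ V) (f : D.OInftySections 1 V),
      D.expand V z.1 hz f.1 = algebraMap D.K (D.Kz z.1) a := by
  obtain ⟨g, rfl⟩ := (D.valued_algebraMap_le_valued_tz_iff z.1 a).mp ha
  obtain ⟨V, hz, G, hG⟩ := D.exists_toK_eq_of_algebraMap_eq (g := g) rfl
  let f : Γ(D.X, (V ⊓ U) ⊓ D.Y) := D.tOn (V ⊓ U) * D.res (inf_le_left.trans inf_le_left) G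
  have htoK (hη) : D.toK _ hη f = D.t * D.toK V hη.1.1 G := by
    rw [map_mul, toK_tOn, toK_res]
  refine ⟨V ⊓ U, inf_le_right, ⟨hz, z.2⟩, ⟨f, fun w => ⟨D.X.presheaf.germ V w.1.1 w.2.1 G, ?_⟩⟩, ?_⟩
  · rw [htoK, zpow_one, algebraMap_germ]
  · exact congrArg (algebraMap D.K (D.Kz z.1)) ((htoK _).trans (by rw [hG]))

theorem exists_valued_sub_expand_le_one {U : D.X.Opens} (z : D.InftyIn U) {y : D.Kz z.1}
    (hy : Valued.v y ≤ Valued.v (D.tz z.1)) :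
    ∃ (V : D.X.Opens) (_ : V ≤ U) (hz : z.1.1 ∈ V) (f : D.OInftySections 1 V),
      Valued.v (y - D.expand V z.1 hz f.1) ≤ 1 := by
  obtain ⟨a, ha⟩ := D.exists_valued_sub_algebraMap_le_one z.1 y
  have hat : Valued.v (algebraMap D.K (D.Kz z.1) a) ≤ Valued.v (D.tz z.1) := by
    have := Valuation.map_sub_le Valued.v hy (ha.trans (D.one_lt_valued_tz z.1).le)
    rwa [sub_sub_cancel] at this
  obtain ⟨V, hVU, hz, f, hf⟩ := D.exists_OInftySections_expand_eq z hat
  exact ⟨V, hVU, hz, f, hf.symm ▸ ha⟩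

end Places

end CurveOverP1

namespace CurveOverP1

variable {k : Type u} [Field k] [Fintype k] (D : CurveOverP1 k) {U : D.X.Opens}

section Logarithm

/-- The expansion at `z` of the sections of `O_X(∞)`, which lies in the domain of the Carlitz
logarithm of `K_z`. -/
def expandDisc (z : D.InftyIn U) : D.OInftySections 1 U →ₗ[k] carlitzDisc k (D.tz z.1) where
  toFun f := ⟨D.expand U z.1 z.2 f.1, D.mem_OInftySections_one_iff.mp f.2 z⟩
  map_add' f g := Subtype.ext (map_add (D.expand U z.1 z.2) f.1 g.1)
  map_smul' a f := Subtype.ext <| by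
    change D.expand U z.1 z.2 (a • f.1) = a • D.expand U z.1 z.2 f.1
    rw [Algebra.smul_def, map_mul, expand_algebraMap, Algebra.smul_def]

/-- The Carlitz logarithm in `K_z` of the sections of `O_X(∞)`. -/
def logAt (z : D.InftyIn U) : D.OInftySections 1 U →ₗ[k] D.Kz z.1 :=
  (carlitzDisc k (D.tz z.1)).subtype ∘ₗ (carlitzLog k (D.one_lt_valued_tz z.1)).toLinearMap ∘ₗ
    D.expandDisc z

theorem carlitzExp_logAt (z : D.InftyIn U) (f : D.OInftySections 1 U) :
    carlitzExp k (D.one_lt_valued_tz z.1) (D.logAt z f) = D.expand U z.1 z.2 f.1 :=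
  carlitzExp_carlitzLog _ (D.expandDisc z f)

theorem valued_logAt (z : D.InftyIn U) (f : D.OInftySections 1 U) :
    Valued.v (D.logAt z f) = Valued.v (D.expand U z.1 z.2 f.1) :=
  valuation_carlitzLog _ (D.expandDisc z f)

theorem valued_logAt_le (z : D.InftyIn U) (f : D.OInftySections 1 U) :
    Valued.v (D.logAt z f) ≤ Valued.v (D.tz z.1) :=
  (carlitzLog k (D.one_lt_valued_tz z.1) (D.expandDisc z f)).2

theorem valued_expand_sub_logAt_le_one (z : D.InftyIn U) (f : D.OInftySections 1 U) :
    Valued.v (D.expand U z.1 z.2 f.1 - D.logAt z f) ≤ 1 :=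
  valuation_sub_carlitzLog_le_one _ (D.expandDisc z f)

theorem logAt_eq_of_carlitzExp_eq {z : D.InftyIn U} {f : D.OInftySections 1 U} {γ : D.Kz z.1}
    (hγ : Valued.v γ ≤ Valued.v (D.tz z.1))
    (hexp : carlitzExp k (D.one_lt_valued_tz z.1) γ = D.expand U z.1 z.2 f.1) :
    D.logAt z f = γ :=
  congrArg Subtype.val (carlitzLog_eq_of_carlitzExp_eq (γ := ⟨γ, hγ⟩) (c := D.expandDisc z f)
    (D.one_lt_valued_tz z.1) hexp)

theorem logAt_res {V : D.X.Opens} (h : V ≤ U) (z : D.InftyIn V) (f : D.OInftySections 1 U) :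
    D.logAt z (D.OInftyRes 1 h f) = D.logAt ⟨z.1, h z.2⟩ f :=
  D.logAt_eq_of_carlitzExp_eq (D.valued_logAt_le ⟨z.1, h z.2⟩ f)
    ((D.carlitzExp_logAt ⟨z.1, h z.2⟩ f).trans (D.expand_res h z.1 z.2 f.1).symm)

theorem logAt_carlitzO (z : D.InftyIn U) (f : Γ(D.X, U)) :
    D.logAt z (D.carlitzO U f) = D.tz z.1 * D.logAt z (D.incl U f) := by
  refine D.logAt_eq_of_carlitzExp_eq ?_ ?_
  · rw [map_mul, valued_logAt]
    exact mul_le_of_le_one_right' (D.mem_range_incl_iff.mp ⟨f, rfl⟩ z)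
  · rw [carlitzExp_mul, carlitzExp_logAt, carlitzMap_apply, ← D.expand_tOn U z.1 z.2, ← map_pow,
      ← map_mul, ← map_add]
    rfl

end Logarithm

section LogSection

variable (U) in
/-- The `A`-module `C(U)`, made into a type of its own to keep its module structure opaque. -/
def CSection : Type u := D.CSections U

instance : AddCommGroup (D.CSection U) := inferInstanceAs (AddCommGroup (D.CSections U))

instance : Module k[X] (D.CSection U) := inferInstanceAs (Module k[X] (D.CSections U))

instance : Module k (D.CSection U) := inferInstanceAs (Module k (D.CSections U))

instance : IsScalarTower k k[X] (D.CSection U) :=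
  inferInstanceAs (IsScalarTower k k[X] (D.CSections U))

/-- The restriction maps of `C`. -/
def restrictC {V : D.X.Opens} (h : V ≤ U) : D.CSection U →ₗ[k[X]] D.CSection V :=
  D.CRes h

/-- The component `c` of a section `(c, (γ_z)_z)` of `C`. -/
def functionPart (x : D.CSection U) : Γ(D.X, U ⊓ D.Y) :=
  (Module.AEval'.of _).symm x.1.1

/-- The component `γ_z` of a section `(c, (γ_z)_z)` of `C`. -/
def component (z : D.InftyIn U) : D.CSection U →ₗ[k] D.Kz z.1 where
  toFun x := (Module.AEval'.of _).symm (x.1.2 z)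
  map_add' x y := map_add (Module.AEval'.of _).symm (x.1.2 z) (y.1.2 z)
  map_smul' a x := map_smul (Module.AEval'.of _).symm a (x.1.2 z)

variable {D} in
theorem CSection_ext {x y : D.CSection U} (h : D.functionPart x = D.functionPart y)
    (h' : ∀ z, D.component z x = D.component z y) : x = y :=
  Subtype.ext (Prod.ext ((Module.AEval'.of _).symm.injective h)
    (funext fun z => (Module.AEval'.of _).symm.injective (h' z)))

theorem carlitzExp_component (z : D.InftyIn U) (x : D.CSection U) :
    carlitzExp k (D.one_lt_valued_tz z.1) (D.component z x) =
      D.expand U z.1 z.2 (D.functionPart x) :=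
  (hasCarlitzExp_iff _).mp (x.2 z)

theorem functionPart_restrictC {V : D.X.Opens} (h : V ≤ U) (x : D.CSection U) :
    D.functionPart (D.restrictC h x) = D.res (inf_le_inf_right _ h) (D.functionPart x) :=
  congrArg (Module.AEval'.of _).symm (D.CRes_fst h x)

theorem component_restrictC {V : D.X.Opens} (h : V ≤ U) (z : D.InftyIn V) (x : D.CSection U) :
    D.component z (D.restrictC h x) = D.component ⟨z.1, h z.2⟩ x :=
  congrArg (Module.AEval'.of (LinearMap.mulLeft k (D.tz z.1))).symm (D.CRes_snd h x z)

theorem functionPart_X_smul (x : D.CSection U) :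
    D.functionPart ((Polynomial.X : k[X]) • x) = carlitzMap (k := k) (D.tOn U) (D.functionPart x) :=
  Module.AEval.of_symm_X_smul _ x.1.1

theorem component_X_smul (z : D.InftyIn U) (x : D.CSection U) :
    D.component z ((Polynomial.X : k[X]) • x) = D.tz z.1 * D.component z x :=
  Module.AEval.of_symm_X_smul (LinearMap.mulLeft k (D.tz z.1)) (x.1.2 z)

theorem component_X_pow_smul (z : D.InftyIn U) (n : ℕ) (x : D.CSection U) :
    D.component z ((Polynomial.X : k[X]) ^ n • x) = D.tz z.1 ^ n * D.component z x :=
  MulModule.of_symm_X_pow_smul (D.tz z.1) n (x.1.2 z)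

/-- The section `(f, (log f)_z)` of `C` attached to a section `f` of `O_X(∞)`. -/
def logSection : D.OInftySections 1 U →ₗ[k] D.CSection U where
  toFun f := ⟨(Module.AEval'.of _ f.1, fun z => Module.AEval'.of _ (D.logAt z f)),
    fun z => (hasCarlitzExp_iff (D.one_lt_valued_tz z.1)).mpr (D.carlitzExp_logAt z f)⟩
  map_add' f g := Subtype.ext (Prod.ext rfl (funext fun z =>
    congrArg (Module.AEval'.of _) (map_add (D.logAt z) f g)))
  map_smul' a f := Subtype.ext (Prod.ext rfl (funext fun z =>
    congrArg (Module.AEval'.of _) (map_smul (D.logAt z) a f)))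

theorem functionPart_logSection (f : D.OInftySections 1 U) :
    D.functionPart (D.logSection f) = f.1 := rfl

theorem component_logSection (z : D.InftyIn U) (f : D.OInftySections 1 U) :
    D.component z (D.logSection f) = D.logAt z f := rfl

theorem logSection_injective : Function.Injective (D.logSection (U := U)) := fun _ _ h =>
  Subtype.ext (congrArg D.functionPart h)

theorem logSection_res {V : D.X.Opens} (h : V ≤ U) (f : D.OInftySections 1 U) :
    D.logSection (D.OInftyRes 1 h f) = D.restrictC h (D.logSection f) := by
  refine CSection_ext ?_ fun z => ?_
  · rw [functionPart_restrictC, functionPart_logSection, functionPart_logSection]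
    rfl
  · rw [component_restrictC, component_logSection, component_logSection, logAt_res]

theorem X_smul_logSection_incl (f : Γ(D.X, U)) :
    (Polynomial.X : k[X]) • D.logSection (D.incl U f) = D.logSection (D.carlitzO U f) := by
  refine CSection_ext ?_ fun z => ?_
  · rw [functionPart_X_smul, functionPart_logSection, functionPart_logSection]
    rfl
  · exact (D.component_X_smul z (D.logSection (D.incl U f))).trans (D.logAt_carlitzO z f).symm

theorem exists_logSection_eq {x : D.CSection U}
    (hx : ∀ z, Valued.v (D.component z x) ≤ Valued.v (D.tz z.1)) :
    ∃ f, D.logSection f = x := by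
  have hmem : D.functionPart x ∈ D.OInftySections 1 U :=
    D.mem_OInftySections_one_iff.mpr fun z => by
      rw [← carlitzExp_component, valuation_carlitzExp _ (hx z)]
      exact hx z
  exact ⟨⟨D.functionPart x, hmem⟩, CSection_ext rfl fun z =>
    D.logAt_eq_of_carlitzExp_eq (hx z) (D.carlitzExp_component z x)⟩

end LogSection

section Projection

/-- The map `O_X(∞) ⊗ A ⟶ C` on sections, which is `f ↦ (f, log f)` on `O_X(∞)`. -/
def projSections (U : D.X.Opens) : k[X] ⊗[k] D.OInftySections 1 U →ₗ[k[X]] D.CSection U :=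
  D.logSection.liftBaseChange k[X]

theorem projSections_tmul (a : k[X]) (f : D.OInftySections 1 U) :
    D.projSections U (a ⊗ₜ f) = a • D.logSection f :=
  LinearMap.liftBaseChange_tmul _ _ _ _

theorem projSections_res {V : D.X.Opens} (h : V ≤ U) (s : k[X] ⊗[k] D.OInftySections 1 U) :
    D.projSections V ((D.OInftyRes 1 h).baseChange k[X] s) = D.restrictC h (D.projSections U s) :=
  PolynomialTensor.liftBaseChange_baseChange (D.logSection_res h) s

/-- The map `O_X(∞) ⊗ A ⟶ C` of presheaves. -/
def projPresheaf : D.OXInfty 1 ⋙ tensorA k ⟶ D.CPresheaf where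
  app U := ModuleCat.ofHom (D.projSections U.unop)
  naturality _ _ i := ModuleCat.hom_ext (LinearMap.ext (D.projSections_res i.unop.le))

end Projection

section Exactness

theorem mem_range_incl_of_sum_eq_zero {n : ℕ} {f : ℕ → D.OInftySections 1 U}
    (hf : ∑ i ∈ Finset.range (n + 2), (Polynomial.X : k[X]) ^ i • D.logSection (f i) = 0) :
    f (n + 1) ∈ LinearMap.range (D.incl U) := by
  refine D.mem_range_incl_iff.mpr fun z => ?_
  have hsum : ∑ i ∈ Finset.range (n + 2), D.tz z.1 ^ i * D.logAt z (f i) = 0 := by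
    have := congrArg (D.component z) hf
    simpa only [map_sum, map_zero, component_X_pow_smul, component_logSection] using this
  rw [← valued_logAt]
  exact valuation_top_coeff_le_one (γ := fun i => D.logAt z (f i)) (D.one_lt_valued_tz z.1)
    (fun i => D.valued_logAt_le z (f i)) hsum

theorem boundarySections_injective (U : D.X.Opens) : Function.Injective (D.boundarySections U) :=
  PolynomialTensor.boundary_injective (D.incl_injective U) (D.carlitzO U)

theorem exact_boundarySections_projSections (U : D.X.Opens) :
    Function.Exact (D.boundarySections U) (D.projSections U) :=
  PolynomialTensor.exact_boundary_liftBaseChange (D.X_smul_logSection_incl) D.logSection_injective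
    fun _ _ => D.mem_range_incl_of_sum_eq_zero

end Exactness

section LocalSurjectivity

theorem component_projSections_X_pow_tmul (z : D.InftyIn U) (n : ℕ) (f : D.OInftySections 1 U) :
    D.component z (D.projSections U (((Polynomial.X : k[X]) ^ n) ⊗ₜ f)) =
      D.tz z.1 ^ n * D.logAt z f :=
  (congrArg (D.component z) (D.projSections_tmul _ f)).trans (D.component_X_pow_smul z n _)

theorem exists_valued_sub_pow_mul_logAt_le (z : D.InftyIn U) {n : ℕ} {γ : D.Kz z.1}
    (hγ : Valued.v γ ≤ Valued.v (D.tz z.1) ^ (n + 1)) :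
    ∃ (V : D.X.Opens) (_ : V ≤ U) (hz : z.1.1 ∈ V) (f : D.OInftySections 1 V),
      Valued.v (γ - D.tz z.1 ^ n * D.logAt ⟨z.1, hz⟩ f) ≤ Valued.v (D.tz z.1) ^ n := by
  have hpos : 0 < Valued.v (D.tz z.1) := zero_lt_one.trans (D.one_lt_valued_tz z.1)
  obtain ⟨y, rfl⟩ : ∃ y, γ = D.tz z.1 ^ n * y :=
    ⟨γ / D.tz z.1 ^ n, (mul_div_cancel₀ _ (pow_ne_zero _ (Valued.v.pos_iff.mp hpos))).symm⟩
  have hy : Valued.v y ≤ Valued.v (D.tz z.1) := by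
    rw [map_mul, map_pow, pow_succ] at hγ
    exact le_of_mul_le_mul_left hγ (pow_pos hpos n)
  obtain ⟨V, hVU, hz, f, hf⟩ := D.exists_valued_sub_expand_le_one z hy
  refine ⟨V, hVU, hz, f, ?_⟩
  have hlog : Valued.v (y - D.logAt ⟨z.1, hz⟩ f) ≤ 1 :=
    sub_add_sub_cancel y _ (D.logAt ⟨z.1, hz⟩ f) ▸
      Valuation.map_add_le Valued.v hf (D.valued_expand_sub_logAt_le_one ⟨z.1, hz⟩ f)
  rw [← mul_sub, map_mul, map_pow]
  exact mul_le_of_le_one_right' hlog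

theorem exists_valued_sub_component_projSections_le_of_le_pow (n : ℕ) (z : D.InftyIn U)
    {γ : D.Kz z.1} (hγ : Valued.v γ ≤ Valued.v (D.tz z.1) ^ (n + 1)) :
    ∃ (V : D.X.Opens) (_ : V ≤ U) (hz : z.1.1 ∈ V) (s : k[X] ⊗[k] D.OInftySections 1 V),
      Valued.v (γ - D.component ⟨z.1, hz⟩ (D.projSections V s)) ≤ Valued.v (D.tz z.1) := by
  induction n generalizing U γ with
  | zero =>
    refine ⟨U, le_rfl, z.2, 0, ?_⟩
    rw [map_zero, map_zero, sub_zero]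
    simpa only [zero_add, pow_one] using hγ
  | succ n ih =>
    obtain ⟨V, hVU, hzV, f, hf⟩ := D.exists_valued_sub_pow_mul_logAt_le z hγ
    obtain ⟨W, hWV, hzW, s, hs⟩ := ih ⟨z.1, hzV⟩ hf
    refine ⟨W, hWV.trans hVU, hzW, ((Polynomial.X : k[X]) ^ (n + 1)) ⊗ₜ D.OInftyRes 1 hWV f + s, ?_⟩
    rw [map_add, map_add, component_projSections_X_pow_tmul, logAt_res, ← sub_sub]
    exact hs

theorem exists_valued_sub_component_projSections_le (z : D.InftyIn U) (γ : D.Kz z.1) :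
    ∃ (V : D.X.Opens) (_ : V ≤ U) (hz : z.1.1 ∈ V) (s : k[X] ⊗[k] D.OInftySections 1 V),
      Valued.v (γ - D.component ⟨z.1, hz⟩ (D.projSections V s)) ≤ Valued.v (D.tz z.1) := by
  have ht := D.one_lt_valued_tz z.1
  obtain ⟨n, hn⟩ := MulArchimedean.arch (Valued.v γ) ht
  exact D.exists_valued_sub_component_projSections_le_of_le_pow n z
    (hn.trans (pow_le_pow_right₀ ht.le n.le_succ))

theorem exists_projSections_eq {x : D.CSection U} {s : k[X] ⊗[k] D.OInftySections 1 U}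
    (hs : ∀ z, Valued.v (D.component z x - D.component z (D.projSections U s)) ≤
      Valued.v (D.tz z.1)) :
    ∃ s', D.projSections U s' = x := by
  obtain ⟨f, hf⟩ := D.exists_logSection_eq (x := x - D.projSections U s) fun z =>
    (congrArg Valued.v (map_sub (D.component z) _ _)).trans_le (hs z)
  refine ⟨1 ⊗ₜ f + s, ?_⟩
  rw [map_add, projSections_tmul, one_smul, hf, sub_add_cancel]

theorem exists_projSections_eq_restrictC (x : D.CSection U) {p : D.X} (hp : p ∈ U) :
    ∃ (V : D.X.Opens) (h : V ≤ U), p ∈ V ∧ ∃ s, D.projSections V s = D.restrictC h x := by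
  by_cases hpY : p ∈ D.Y
  · exact ⟨U ⊓ D.Y, inf_le_left, ⟨hp, hpY⟩,
      D.exists_projSections_eq (s := 0) fun z => (z.1.2 z.2.2).elim⟩
  · obtain ⟨W, hpW, hW⟩ := D.exists_opens_infty_eq ⟨p, hpY⟩
    obtain ⟨V, hV, hpV, s, hs⟩ := D.exists_valued_sub_component_projSections_le (U := U ⊓ W)
      ⟨⟨p, hpY⟩, hp, hpW⟩ (D.component ⟨⟨p, hpY⟩, hp⟩ x)
    refine ⟨V, hV.trans inf_le_left, hpV, D.exists_projSections_eq (s := s) ?_⟩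
    rintro ⟨z, hz⟩
    obtain rfl := hW z (hV hz).2
    exact hs

theorem isLocallySurjective_projPresheaf : TopCat.Presheaf.IsLocallySurjective D.projPresheaf := by
  rw [TopCat.Presheaf.isLocallySurjective_iff]
  intro U x p hp
  obtain ⟨V, h, hpV, s, hs⟩ := D.exists_projSections_eq_restrictC x hp
  exact ⟨V, h, ⟨s, hs⟩, hpV⟩

end LocalSurjectivity

end CurveOverP1

end

theorem theorem1 (k : Type u) [Field k] [Fintype k] (D : CurveOverP1 k) :
    ∃ (π : D.sheafTensor (D.OXInfty 1) ⟶ D.C) (w : D.boundary ≫ π = 0),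
      (ShortComplex.mk D.boundary π w).ShortExact :=
  exists_shortExact_presheafToSheaf (f := D.boundaryPresheaf) (g := D.projPresheaf)
    (fun U => D.boundarySections_injective U.unop)
    (fun U => D.exact_boundarySections_projSections U.unop) D.isLocallySurjective_projPresheaf
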